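/- Let $M$ be a two-dimensional Hausdorff $C^\infty$ manifold without boundary, and let $g_{ab}$ be a Lorentzian metric on $M$, i.e. a symmetric covariant tensor field of signature $(-,+)$ at every point. Assume that $g$ is of class $C^4$ and that $(M,g)$ is time-orientable, i.e. that there is a continuous vector field $X$ on $M$ with $g(X,X)<0$ everywhere. Let $\Lambda, G$ be real numbers with $G\neq 0$ (the cosmological constant and Newton's constant), and let $p\in M$. Then there are an open neighborhood $U$ of $p$ and a symmetric contravariant tensor field $T^{ab}$ of class $C^1$ on $U$ such that, everywhere on $U$, $$R-\Lambda = 8\pi G\, T \qquad\text{and}\qquad \nabla_b T^{ab}=0 .$$ Here $T=g_{ab}T^{ab}$ is the trace, $\nabla_b T^{ab}=\partial_b T^{ab}+\Gamma^a_{bc}T^{cb}+\Gamma^b_{bc}T^{ac}$ is the divergence with respect to the Levi-Civita connection of $g$, whose Christoffel symbols are $\Gamma^a_{bc}$, and $R=g^{bd}R^a{}_{bad}$ is the Ricci scalar, where $$R^a{}_{bcd}=\partial_c\Gamma^a_{bd}-\partial_d\Gamma^a_{bc}+\Gamma^a_{cf}\Gamma^f_{bd}-\Gamma^a_{df}\Gamma^f_{bc}.$$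 (All the expressions in components are taken in smooth local coordinates, and the equations hold in every smooth coordinate system.) -/

import Mathlib

open scoped Manifold ContDiff Topology

noncomputable section

namespace Spacetime2

/-- The model space of coordinates `(x⁰, x¹)`. -/
abbrev Coord : Type := EuclideanSpace ℝ (Fin 2)

/-- The partial derivative `∂f/∂xᶜ` of a function of the two coordinates. -/
def partialDeriv (c : Fin 2) (f : Coord → ℝ) (y : Coord) : ℝ :=
  fderiv ℝ f y (EuclideanSpace.single c 1)

/-! ### Tensor calculus for the matrix of components of a metric in one coordinate system -/

/-- The Christoffel symbol `Γᵃ_{bc}` of the metric with components `h y b c` at `y`. -/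
def christoffel (h : Coord → Matrix (Fin 2) (Fin 2) ℝ) (a b c : Fin 2) (y : Coord) : ℝ :=
  (1 / 2) * ∑ d, (h y)⁻¹ a d *
    (partialDeriv b (fun z => h z d c) y + partialDeriv c (fun z => h z d b) y
      - partialDeriv d (fun z => h z b c) y)

/-- The Riemann tensor `Rᵃ_{bcd} = ∂_c Γᵃ_{bd} - ∂_d Γᵃ_{bc} + Γᵃ_{cf} Γᶠ_{bd} - Γᵃ_{df} Γᶠ_{bc}`. -/
def riemann (h : Coord → Matrix (Fin 2) (Fin 2) ℝ) (a b c d : Fin 2) (y : Coord) : ℝ :=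
  partialDeriv c (christoffel h a b d) y - partialDeriv d (christoffel h a b c) y
    + ∑ f, christoffel h a c f y * christoffel h f b d y
    - ∑ f, christoffel h a d f y * christoffel h f b c y

/-- The Ricci tensor `R_{bd} = Rᵃ_{bad}`. -/
def ricci (h : Coord → Matrix (Fin 2) (Fin 2) ℝ) (b d : Fin 2) (y : Coord) : ℝ :=
  ∑ a, riemann h a b a d y

/-- The Ricci scalar `R = R_{bd} gᵇᵈ`. -/
def ricciScalar (h : Coord → Matrix (Fin 2) (Fin 2) ℝ) (y : Coord) : ℝ :=
  ∑ b, ∑ d, ricci h b d y * (h y)⁻¹ b d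

/-- The trace `T = g_{ab} Tᵃᵇ`. -/
def trace (h S : Coord → Matrix (Fin 2) (Fin 2) ℝ) (y : Coord) : ℝ :=
  ∑ a, ∑ b, h y a b * S y a b

/-- The divergence `∇_b Tᵃᵇ = ∂_b Tᵃᵇ + Γᵃ_{bc} Tᶜᵇ + Γᵇ_{bc} Tᵃᶜ`. -/
def divergence (h S : Coord → Matrix (Fin 2) (Fin 2) ℝ) (a : Fin 2) (y : Coord) : ℝ :=
  ∑ b, (partialDeriv b (fun z => S z a b) y
    + ∑ c, christoffel h a b c y * S y c b
    + ∑ c, christoffel h b b c y * S y a c)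

/-! ### Tensor fields on a surface -/

section Manifold

variable (M : Type*) [TopologicalSpace M] [ChartedSpace Coord M]

/-- Fields of covariant 2-tensors: a bilinear form on each tangent space. -/
abbrev CovTensorField : Type _ := (x : M) → LinearMap.BilinForm ℝ (TangentSpace (𝓡 2) x)

/-- Fields of contravariant 2-tensors: a bilinear form on each cotangent space. -/
abbrev ContraTensorField : Type _ :=
  (x : M) → LinearMap.BilinForm ℝ (Module.Dual ℝ (TangentSpace (𝓡 2) x))

variable {M}

/-- The coordinate vector `∂/∂xᵃ` of the chart `e`, at the point with coordinates `y`. -/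
def coordVector (e : OpenPartialHomeomorph M Coord) (a : Fin 2) (y : Coord) :
    TangentSpace (𝓡 2) (e.symm y) :=
  mfderiv (𝓡 2) (𝓡 2) e.symm y (EuclideanSpace.single a (1 : ℝ) : Coord)

/-- The coordinate covector `dxᵃ` of the chart `e`, at the point with coordinates `y`. -/
def coordCovector (e : OpenPartialHomeomorph M Coord) (a : Fin 2) (y : Coord) :
    Module.Dual ℝ (TangentSpace (𝓡 2) (e.symm y)) :=
  (mfderiv (𝓡 2) 𝓘(ℝ, ℝ) (fun z : M => e z a) (e.symm y)).toLinearMap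

/-- The components `g_{ab}` in the chart `e`, as functions of the coordinates. -/
def CovTensorField.components (g : CovTensorField M) (e : OpenPartialHomeomorph M Coord)
    (y : Coord) : Matrix (Fin 2) (Fin 2) ℝ :=
  Matrix.of fun a b => g (e.symm y) (coordVector e a y) (coordVector e b y)

/-- The components `Tᵃᵇ` in the chart `e`, as functions of the coordinates. -/
def ContraTensorField.components (T : ContraTensorField M) (e : OpenPartialHomeomorph M Coord)
    (y : Coord) : Matrix (Fin 2) (Fin 2) ℝ :=
  Matrix.of fun a b => T (e.symm y) (coordCovector e a y) (coordCovector e b y)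

/-- `g` is a Lorentzian metric, i.e. symmetric of signature `(-,+)` at every point. -/
def IsLorentzian (g : CovTensorField M) : Prop :=
  ∀ x : M, (∀ v w, g x v w = g x w v) ∧
    ∃ b : Module.Basis (Fin 2) ℝ (TangentSpace (𝓡 2) x),
      g x (b 0) (b 0) = -1 ∧ g x (b 1) (b 1) = 1 ∧ g x (b 0) (b 1) = 0

/-- `g` is of class `Cᵏ`: its components in every smooth chart are. -/
def CovTensorField.IsOfClass (g : CovTensorField M) (k : ℕ∞) : Prop :=
  ∀ e ∈ IsManifold.maximalAtlas (𝓡 2) ∞ M, ∀ a b : Fin 2,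
    ContDiffOn ℝ k (fun y => g.components e y a b) e.target

/-- `T` is of class `Cᵏ` on the open set `U`: its components in every smooth chart are. -/
def ContraTensorField.IsOfClassOn (T : ContraTensorField M) (k : ℕ∞) (U : Set M) : Prop :=
  ∀ e ∈ IsManifold.maximalAtlas (𝓡 2) ∞ M, ∀ a b : Fin 2,
    ContDiffOn ℝ k (fun y => T.components e y a b) (e.target ∩ e.symm ⁻¹' U)

/-- There is a continuous vector field that is timelike for `g` everywhere. -/
def IsTimeOrientable [IsManifold (𝓡 2) 1 M] (g : CovTensorField M) : Prop :=
  ∃ X : (x : M) → TangentSpace (𝓡 2) x,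
    Continuous (fun x => (⟨x, X x⟩ : TangentBundle (𝓡 2) M)) ∧ ∀ x, g x (X x) (X x) < 0

end Manifold

end Spacetime2

end

/-! ### Linear transport equations in the plane, solved in the class C¹ -/

section Transport

open Set Filter MeasureTheory
open scoped NNReal

/-! Nothing about the Ricci scalar matters except its regularity: since g is C⁴, the function F = (R
- Λ)/(8πG) is C² near p, and any C² function is locally the trace of a symmetric divergence-free C¹
tensor. In dimension two this can be seen in a null frame.

Near p there are two independent null fields l = (1, v) and n = (1, w), and g⁻¹ = k (l ⊗ n + n ⊗ l)
for a function k. Take T = A l ⊗ l + B n ⊗ n + (F/2) g⁻¹. The trace is F whatever A and B are,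
because l and n are null and g⁻¹ has trace 2. Null curves of a surface are pregeodesics, so the
divergence of A l ⊗ l is again a multiple of l, namely (l(A) + c A) l (`divergence_null`); that of
(F/2) g⁻¹ is the gradient of F/2 (`divergence_smul_inv`), which is k (n(F/2) l + l(F/2) n). The
system ∇·T = 0 therefore decouples into two scalar linear transport equations, l(A) + c A = -k
n(F/2) and n(B) + c' B = -k l(F/2), where c and c' are the coefficients `nullCoeff` of l and n. All
their coefficients and sources are C¹, and the method of characteristics gives C¹ solutions; this
rests on the C¹ dependence of a scalar flow on its initial value (`exists_contDiff_flow`). The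
construction is `exists_local_tensor_of_ne_zero`.

The tensor is built in one chart around p. The equations hold in every other chart because the Ricci
scalar and the trace are scalars and the divergence is a vector: `IsPullback.ricciScalar_eq`,
`IsPullback.trace_eq`, `IsPullback.divergence_eq`. These laws are derived from the transformation
law of the Christoffel symbols. -/

theorem ContDiffAt.exists_contDiff_hasCompactSupport {E : Type*} [NormedAddCommGroup E]
    [NormedSpace ℝ E] [FiniteDimensional ℝ E] {f : E → ℝ} {p : E} (hf : ContDiffAt ℝ 1 f p) :
    ∃ g : E → ℝ, ContDiff ℝ 1 g ∧ HasCompactSupport g ∧ g =ᶠ[𝓝 p] f := by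
  obtain ⟨r, hr, hball⟩ := Metric.eventually_nhds_iff_ball.1 (hf.eventually (by simp))
  -- The outer radius r / 2 keeps the closed support inside the ball of radius r where f is C¹.
  let c : ContDiffBump p := ⟨r / 4, r / 2, by positivity, by linarith⟩
  refine ⟨fun y => c y * f y, ?_, c.hasCompactSupport.mul_right, ?_⟩
  · rw [contDiff_iff_contDiffAt]
    intro y
    by_cases hy : y ∈ Metric.ball p r
    · exact c.contDiff.contDiffAt.mul (hball y hy)
    · have hy' : y ∉ tsupport c := by
        rw [c.tsupport_eq]
        intro h
        exact hy (Metric.closedBall_subset_ball (by simp [c]; linarith) h)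
      have h0 : (fun y => c y * f y) =ᶠ[𝓝 y] fun _ => 0 := by
        filter_upwards [notMem_tsupport_iff_eventuallyEq.1 hy'] with z hz
        simp [hz]
      exact contDiffAt_const.congr_of_eventuallyEq h0
  · filter_upwards [c.eventuallyEq_one] with y hy
    simp [hy]

theorem contDiff_one_of_partials {f f₁ f₂ : ℝ → ℝ → ℝ}
    (h₁ : ∀ t x, HasDerivAt (fun s => f s x) (f₁ t x) t)
    (h₂ : ∀ t x, HasDerivAt (f t) (f₂ t x) x)
    (c₁ : Continuous fun z : ℝ × ℝ => f₁ z.1 z.2) (c₂ : Continuous fun z : ℝ × ℝ => f₂ z.1 z.2) :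
    ContDiff ℝ 1 fun z : ℝ × ℝ => f z.1 z.2 := by
  rw [contDiff_one_iff_hasFDerivAt]
  let g₁ : ℝ → ℝ → ℝ →L[ℝ] ℝ := fun t x => ContinuousLinearMap.toSpanSingleton ℝ (f₁ t x)
  let g₂ : ℝ → ℝ → ℝ →L[ℝ] ℝ := fun t x => ContinuousLinearMap.toSpanSingleton ℝ (f₂ t x)
  have k₁ : Continuous fun z : ℝ × ℝ => g₁ z.1 z.2 :=
    (ContinuousLinearMap.toSpanSingletonCLE (𝕜 := ℝ) (E := ℝ)).continuous.comp c₁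
  have k₂ : Continuous fun z : ℝ × ℝ => g₂ z.1 z.2 :=
    (ContinuousLinearMap.toSpanSingletonCLE (𝕜 := ℝ) (E := ℝ)).continuous.comp c₂
  refine ⟨fun z => (g₁ z.1 z.2).coprod (g₂ z.1 z.2), ?_, fun z => ?_⟩
  · exact (ContinuousLinearMap.coprodEquivL ℝ).continuous.comp (k₁.prodMk k₂)
  · exact (hasStrictFDerivAt_uncurry_coprod (f := f) (f₁ := g₁) (f₂ := g₂)
      (Eventually.of_forall fun v => (h₁ v.1 v.2).hasFDerivAt)
      (Eventually.of_forall fun v => (h₂ v.1 v.2).hasFDerivAt)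
      k₁.continuousAt k₂.continuousAt).hasFDerivAt

/-- The derivative in the upper limit is G itself, and the other partial derivative is the integral
of G'. Both are continuous, so no differentiability of G in its first variable is needed. -/
theorem contDiff_one_primitive {G G' : ℝ → ℝ → ℝ} (a : ℝ)
    (hG : Continuous fun z : ℝ × ℝ => G z.1 z.2) (hG' : Continuous fun z : ℝ × ℝ => G' z.1 z.2)
    (hd : ∀ s x, HasDerivAt (G s) (G' s x) x) :
    ContDiff ℝ 1 fun z : ℝ × ℝ => ∫ s in a..z.1, G s z.2 := by
  have hGt : ∀ x, Continuous fun s => G s x := fun x => hG.comp (by fun_prop : Continuous fun s : ℝ => (s, x))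
  have hGt' : ∀ x, Continuous fun s => G' s x := fun x => hG'.comp (by fun_prop : Continuous fun s : ℝ => (s, x))
  refine contDiff_one_of_partials (f := fun t x => ∫ s in a..t, G s x) (f₁ := G)
    (f₂ := fun t x => ∫ s in a..t, G' s x) ?_ ?_ hG ?_
  · intro t x
    exact ((hGt x).integral_hasStrictDerivAt a t).hasDerivAt
  · intro t x
    have hK : IsCompact (uIcc a t ×ˢ Metric.closedBall x 1) :=
      isCompact_uIcc.prod (isCompact_closedBall x 1)
    obtain ⟨C, hC⟩ := hK.exists_bound_of_continuousOn hG'.continuousOn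
    refine (intervalIntegral.hasDerivAt_integral_of_dominated_loc_of_deriv_le
      (F := fun x s => G s x) (F' := fun x s => G' s x) (bound := fun _ => C)
      (Metric.closedBall_mem_nhds x one_pos) (Eventually.of_forall fun y =>
        (hGt y).aestronglyMeasurable) ((hGt x).intervalIntegrable _ _)
        (hGt' x).aestronglyMeasurable ?_ (by simp) ?_).2
    · exact Eventually.of_forall fun s hs y hy => hC (s, y) ⟨uIoc_subset_uIcc hs, hy⟩
    · exact Eventually.of_forall fun s _ y _ => hd s y
  · have := intervalIntegral.continuous_parametric_intervalIntegral_of_continuous (μ := volume)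
      (f := fun (z : ℝ × ℝ) s => G' s z.2) (a₀ := a) (s := fun z : ℝ × ℝ => z.1)
      (hG'.comp (by fun_prop : Continuous fun w : (ℝ × ℝ) × ℝ => (w.2, w.1.2))) (by fun_prop)
    exact this

theorem exists_global_solution {v : ℝ → ℝ → ℝ} {K L : ℝ≥0} (hv : Continuous fun z : ℝ × ℝ => v z.1 z.2)
    (hK : ∀ t, LipschitzWith K (v t)) (hL : ∀ t x, ‖v t x‖ ≤ L) (t₀ x : ℝ) :
    ∃ α : ℝ → ℝ, α t₀ = x ∧ ∀ t, HasDerivAt α (v t (α t)) t := by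
  have loc : ∀ a : ℝ≥0, ∃ α : ℝ → ℝ, α t₀ = x ∧
      ∀ t ∈ Ioo (t₀ - a) (t₀ + a), HasDerivAt α (v t (α t)) t := by
    intro a
    -- A curve of speed at most L cannot leave the ball of radius L * a within time a, so the global
    -- bound lets the time interval be arbitrarily long.
    have hp : IsPicardLindelof v (tmin := t₀ - a) (tmax := t₀ + a) ⟨t₀, by simp⟩ x (L * a) 0 L K := by
      refine ⟨fun t _ => (hK t).lipschitzOnWith, fun y _ => ?_, fun t _ y _ => hL t y, by simp⟩
      exact (hv.comp (by fun_prop : Continuous fun s : ℝ => (s, y))).continuousOn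
    obtain ⟨α, h0, h1⟩ := hp.exists_eq_forall_mem_Icc_hasDerivWithinAt₀
    exact ⟨α, h0, fun t ht => (h1 t (Ioo_subset_Icc_self ht)).hasDerivAt (Icc_mem_nhds ht.1 ht.2)⟩
  choose γ hγ0 hγ using loc
  have uniq : ∀ a b : ℝ≥0, ∀ t ∈ Ioo (t₀ - a) (t₀ + a), a ≤ b → γ a t = γ b t := by
    intro a b t ht hab
    have hab' : (a : ℝ) ≤ b := hab
    have ha : (0 : ℝ) < a := by linarith [ht.1, ht.2]
    refine ODE_solution_unique_of_mem_Ioo (v := v) (s := fun _ => univ) (K := K) (t₀ := t₀)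
      (fun t _ => (hK t).lipschitzOnWith) ⟨by linarith, by linarith⟩
      (fun t ht => ⟨hγ a t ht, mem_univ _⟩) (fun t ht => ⟨hγ b t ?_, mem_univ _⟩)
      (by rw [hγ0, hγ0]) ht
    exact ⟨by linarith [ht.1], by linarith [ht.2]⟩
  have mem : ∀ s, s ∈ Ioo (t₀ - (‖s - t₀‖₊ + 1 : ℝ≥0)) (t₀ + (‖s - t₀‖₊ + 1 : ℝ≥0)) := by
    intro s
    have h1 := abs_le.1 (le_refl |s - t₀|)
    push_cast
    rw [Real.norm_eq_abs]
    exact ⟨by linarith [h1.1], by linarith [h1.2]⟩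
  -- The solutions on growing intervals agree by uniqueness; adding 1 to |t - t₀| makes t interior
  -- to the interval used at t.
  refine ⟨fun t => γ (‖t - t₀‖₊ + 1) t, by simp [hγ0], fun t => ?_⟩
  set b : ℝ≥0 := ‖t - t₀‖₊ + 1 with hb
  refine (hγ b t (mem t)).congr_of_eventuallyEq ?_
  filter_upwards [Ioo_mem_nhds (mem t).1 (mem t).2] with s hs
  rcases le_total (‖s - t₀‖₊ + 1) b with h | h
  · exact uniq _ _ s (mem s) h
  · exact (uniq _ _ s hs h).symm

/-- The mean slope of `f` between `a` and `b`, in terms of the derivative `f'`. -/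
noncomputable def meanSlope (f' : ℝ → ℝ → ℝ) (s a b : ℝ) : ℝ :=
  ∫ θ in (0 : ℝ)..1, f' s (a + θ * (b - a))

theorem continuous_meanSlope {f' : ℝ → ℝ → ℝ} (hf' : Continuous fun z : ℝ × ℝ => f' z.1 z.2) :
    Continuous fun z : ℝ × ℝ × ℝ => meanSlope f' z.1 z.2.1 z.2.2 := by
  unfold meanSlope
  exact intervalIntegral.continuous_parametric_intervalIntegral_of_continuous' (μ := volume)
    (f := fun (z : ℝ × ℝ × ℝ) θ => f' z.1 (z.2.1 + θ * (z.2.2 - z.2.1)))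
    (hf'.comp (by fun_prop : Continuous fun w : (ℝ × ℝ × ℝ) × ℝ =>
      (w.1.1, w.1.2.1 + w.2 * (w.1.2.2 - w.1.2.1)))) 0 1

theorem sub_eq_meanSlope_mul {f f' : ℝ → ℝ → ℝ} (hf' : Continuous fun z : ℝ × ℝ => f' z.1 z.2)
    (hd : ∀ s x, HasDerivAt (f s) (f' s x) x) (s a b : ℝ) :
    f s b - f s a = meanSlope f' s a b * (b - a) := by
  have h : ∀ θ ∈ uIcc (0 : ℝ) 1, HasDerivAt (fun θ => f s (a + θ * (b - a)))
      (f' s (a + θ * (b - a)) * (b - a)) θ := by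
    intro θ _
    have h1 : HasDerivAt (fun θ : ℝ => a + θ * (b - a)) (b - a) θ := by
      simpa using ((hasDerivAt_id θ).mul_const (b - a)).const_add a
    exact (hd s _).comp θ h1
  have hc : Continuous fun θ : ℝ => f' s (a + θ * (b - a)) :=
    hf'.comp (by fun_prop : Continuous fun θ : ℝ => (s, a + θ * (b - a)))
  have := intervalIntegral.integral_eq_sub_of_hasDerivAt h
    ((hc.mul continuous_const).intervalIntegrable _ _)
  rw [intervalIntegral.integral_mul_const] at this
  simp only [one_mul, zero_mul, add_zero, add_sub_cancel] at this
  exact this.symm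

/-- The flow of a scalar ordinary differential equation with a compactly supported right-hand
side of class `C¹` is of class `C¹`. -/
theorem exists_contDiff_flow {v : ℝ → ℝ → ℝ} (hv : ContDiff ℝ 1 fun z : ℝ × ℝ => v z.1 z.2)
    (hs : HasCompactSupport fun z : ℝ × ℝ => v z.1 z.2) (t₀ : ℝ) :
    ∃ Φ J : ℝ → ℝ → ℝ, (∀ x, Φ t₀ x = x) ∧ (∀ t x, HasDerivAt (fun s => Φ s x) (v t (Φ t x)) t) ∧
      (∀ t x, HasDerivAt (Φ t) (J t x) x) ∧ (∀ t x, 0 < J t x) ∧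
      Continuous (fun z : ℝ × ℝ => J z.1 z.2) ∧ ContDiff ℝ 1 fun z : ℝ × ℝ => Φ z.1 z.2 := by
  have hvc := hv.continuous
  obtain ⟨L, hL⟩ := hs.exists_bound_of_continuous hvc
  obtain ⟨K, hK⟩ := hv.lipschitzWith_of_hasCompactSupport hs one_ne_zero
  have hKv : ∀ t, LipschitzWith K (v t) := by
    intro t
    have := hK.comp (LipschitzWith.prodMk_left (α := ℝ) (β := ℝ) t)
    simpa using! this
  have hL' : ∀ t x, ‖v t x‖ ≤ L.toNNReal := fun t x => (hL (t, x)).trans (Real.le_coe_toNNReal L)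
  let v' : ℝ → ℝ → ℝ := fun t x => fderiv ℝ (fun z : ℝ × ℝ => v z.1 z.2) (t, x) (0, 1)
  have hv'c : Continuous fun z : ℝ × ℝ => v' z.1 z.2 :=
    (hv.continuous_fderiv one_ne_zero).clm_apply continuous_const
  have hv'd : ∀ s x, HasDerivAt (v s) (v' s x) x := by
    intro s x
    have h1 := ((hv.differentiable one_ne_zero) (s, x)).hasFDerivAt
    have h2 : HasDerivAt (fun x : ℝ => (s, x)) (0, 1) x :=
      (hasDerivAt_const x s).prodMk (hasDerivAt_id x)
    exact h1.comp_hasDerivAt x h2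
  have hv'K : ∀ s x, ‖v' s x‖ ≤ K := fun s x => by
    rw [← (hv'd s x).deriv]
    exact norm_deriv_le_of_lipschitz (hKv s)
  have hmK : ∀ s a b, ‖meanSlope v' s a b‖ ≤ K := by
    intro s a b
    simpa [meanSlope] using intervalIntegral.norm_integral_le_of_norm_le_const (a := (0 : ℝ)) (b := 1)
      (fun θ _ => hv'K s (a + θ * (b - a)))
  choose φ hφ0 hφ using fun x => exists_global_solution hvc hKv hL' t₀ x
  have hφc : ∀ x, Continuous (φ x) := fun x =>
    continuous_iff_continuousAt.2 fun t => (hφ x t).continuousAt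
  let m : ℝ → ℝ → ℝ → ℝ := fun x y s => meanSlope v' s (φ x s) (φ y s)
  have hmc : ∀ x y, Continuous (m x y) := fun x y =>
    (continuous_meanSlope hv'c).comp (continuous_id.prodMk ((hφc x).prodMk (hφc y)))
  -- In one space dimension the difference of two solutions solves a homogeneous linear equation
  -- whose coefficient is the mean slope of v between them, so it integrates in closed form. This
  -- formula yields the Lipschitz bound, the derivative in the initial value (let y tend to x) and
  -- the positivity of J, with no appeal to the variational equation.
  have key : ∀ x y t, φ y t - φ x t = (y - x) * Real.exp (∫ s in t₀..t, m x y s) := by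
    intro x y t
    let w : ℝ → ℝ := fun t => (φ y t - φ x t) * Real.exp (-∫ s in t₀..t, m x y s)
    have hw : ∀ t, HasDerivAt w 0 t := by
      intro t
      have h1 := ((hφ y t).sub (hφ x t)).mul
        (((hmc x y).integral_hasStrictDerivAt t₀ t).hasDerivAt.neg.exp)
      refine h1.congr_deriv ?_
      rw [sub_eq_meanSlope_mul hv'c hv'd]
      simp only [m, Pi.sub_apply]
      ring
    have hconst := is_const_of_deriv_eq_zero (fun t => (hw t).differentiableAt)
      (fun t => (hw t).deriv) t t₀
    simp only [w, hφ0, intervalIntegral.integral_same, neg_zero, Real.exp_zero, mul_one] at hconst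
    rw [← hconst, mul_assoc, ← Real.exp_add]
    simp
  have hlip : ∀ x y t, |φ y t - φ x t| ≤ Real.exp (K * |t - t₀|) * |y - x| := by
    intro x y t
    rw [key x y t, abs_mul, Real.abs_exp, mul_comm]
    gcongr
    refine (le_abs_self _).trans ?_
    exact intervalIntegral.norm_integral_le_of_norm_le_const fun s _ => hmK _ _ _
  have hφj : Continuous fun z : ℝ × ℝ => φ z.2 z.1 := by
    rw [continuous_iff_continuousAt]
    rintro ⟨t, x⟩
    have h0 : Tendsto (fun z : ℝ × ℝ => Real.exp (K * |z.1 - t₀|) * |z.2 - x| + |φ x z.1 - φ x t|)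
        (𝓝 (t, x)) (𝓝 0) := by
      have : Continuous fun z : ℝ × ℝ =>
          Real.exp (K * |z.1 - t₀|) * |z.2 - x| + |φ x z.1 - φ x t| := by
        have := (hφc x).comp (continuous_fst (X := ℝ) (Y := ℝ))
        simp only [Function.comp_def] at this
        fun_prop
      simpa using this.tendsto (t, x)
    rw [ContinuousAt, tendsto_iff_dist_tendsto_zero]
    refine squeeze_zero (fun _ => dist_nonneg) (fun z => ?_) h0
    rw [Real.dist_eq]
    calc |φ z.2 z.1 - φ x t| = |(φ z.2 z.1 - φ x z.1) + (φ x z.1 - φ x t)| := by ring_nf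
      _ ≤ _ := (abs_add_le _ _).trans (add_le_add_left (hlip _ _ _) _)
  let J : ℝ → ℝ → ℝ := fun t x => Real.exp (∫ s in t₀..t, m x x s)
  have hmj : Continuous fun w : (ℝ × ℝ) × ℝ => m w.1.1 w.1.2 w.2 :=
    (continuous_meanSlope hv'c).comp (continuous_snd.prodMk
      ((hφj.comp (by fun_prop : Continuous fun w : (ℝ × ℝ) × ℝ => (w.2, w.1.1))).prodMk
      (hφj.comp (by fun_prop : Continuous fun w : (ℝ × ℝ) × ℝ => (w.2, w.1.2)))))
  have hJc : Continuous fun z : ℝ × ℝ => J z.1 z.2 := by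
    refine Real.continuous_exp.comp ?_
    exact intervalIntegral.continuous_parametric_intervalIntegral_of_continuous (μ := volume)
      (f := fun (z : ℝ × ℝ) s => m z.2 z.2 s) (s := fun z : ℝ × ℝ => z.1)
      (hmj.comp (by fun_prop : Continuous fun w : (ℝ × ℝ) × ℝ => ((w.1.2, w.1.2), w.2)))
      (by fun_prop)
  have hJd : ∀ t x, HasDerivAt (fun x => φ x t) (J t x) x := by
    intro t x
    rw [hasDerivAt_iff_tendsto_slope]
    have hc : Continuous fun y => Real.exp (∫ s in t₀..t, m x y s) := by
      refine Real.continuous_exp.comp ?_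
      exact intervalIntegral.continuous_parametric_intervalIntegral_of_continuous' (μ := volume)
        (f := fun (y : ℝ) s => m x y s)
        (hmj.comp (by fun_prop : Continuous fun w : ℝ × ℝ => ((x, w.1), w.2))) t₀ t
    refine ((hc.tendsto x).mono_left nhdsWithin_le_nhds).congr' ?_
    filter_upwards [self_mem_nhdsWithin] with y hy
    have hy' : y - x ≠ 0 := sub_ne_zero.2 hy
    rw [slope_def_field, key x y t]
    field_simp
  refine ⟨fun t x => φ x t, J, hφ0, fun t x => hφ x t, hJd, fun t x => Real.exp_pos _, hJc, ?_⟩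
  exact contDiff_one_of_partials (f₁ := fun t x => v t (φ x t)) (fun t x => hφ x t) hJd
    (hvc.comp (continuous_fst.prodMk hφj)) hJc

/-- Local solvability of linear transport equations `A_t + v A_x + c A = f` in the class `C¹`. -/
theorem exists_transport_solution {v c f : ℝ × ℝ → ℝ} {p : ℝ × ℝ} (hv : ContDiffAt ℝ 1 v p)
    (hc : ContDiffAt ℝ 1 c p) (hf : ContDiffAt ℝ 1 f p) :
    ∃ A : ℝ × ℝ → ℝ, ContDiffAt ℝ 1 A p ∧
      ∀ᶠ y in 𝓝 p, fderiv ℝ A y (1, v y) + c y * A y = f y := by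
  -- Only germs at p matter, so the data are replaced by globally defined C¹ functions; compact
  -- support of v₁ makes its flow complete.
  obtain ⟨v₁, hv₁, hv₁s, hv₁e⟩ := hv.exists_contDiff_hasCompactSupport
  obtain ⟨c₁, hc₁, -, hc₁e⟩ := hc.exists_contDiff_hasCompactSupport
  obtain ⟨f₁, hf₁, -, hf₁e⟩ := hf.exists_contDiff_hasCompactSupport
  obtain ⟨t₀, x₀⟩ := p
  obtain ⟨Φ, J, hΦ0, hΦt, hΦx, hJ, hJc, hΦ⟩ :=
    exists_contDiff_flow (v := fun t x => v₁ (t, x)) hv₁ hv₁s t₀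
  -- Ψ straightens the characteristics: each curve with fixed x is carried to an integral curve of
  -- (1, v₁).
  let Ψ : ℝ × ℝ → ℝ × ℝ := fun z => (z.1, Φ z.1 z.2)
  have hΨ : ContDiff ℝ 1 Ψ := contDiff_fst.prodMk hΦ
  have alongx : ∀ g : ℝ × ℝ → ℝ, ContDiff ℝ 1 g → ∃ g' : ℝ → ℝ → ℝ,
      (Continuous fun z : ℝ × ℝ => g' z.1 z.2) ∧ ∀ s x, HasDerivAt (fun x => g (s, x)) (g' s x) x := by
    intro g hg
    refine ⟨fun s x => fderiv ℝ g (s, x) (0, 1),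
      (hg.continuous_fderiv one_ne_zero).clm_apply continuous_const, fun s x => ?_⟩
    exact ((hg.differentiable one_ne_zero) (s, x)).hasFDerivAt.comp_hasDerivAt x
      ((hasDerivAt_const x s).prodMk (hasDerivAt_id x))
  have prim : ∀ g : ℝ × ℝ → ℝ, ContDiff ℝ 1 g →
      ContDiff ℝ 1 fun z : ℝ × ℝ => ∫ s in t₀..z.1, g (s, z.2) := by
    intro g hg
    obtain ⟨g', hg'c, hg'⟩ := alongx g hg
    exact contDiff_one_primitive (G := fun s x => g (s, x)) t₀ hg.continuous hg'c hg'
  have primd : ∀ g : ℝ × ℝ → ℝ, ContDiff ℝ 1 g → ∀ t x,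
      HasDerivAt (fun t => ∫ s in t₀..t, g (s, x)) (g (t, x)) t := fun g hg t x =>
    ((hg.continuous.comp (by fun_prop : Continuous fun s : ℝ => (s, x))).integral_hasStrictDerivAt
      t₀ t).hasDerivAt
  let C : ℝ × ℝ → ℝ := fun z => ∫ s in t₀..z.1, (c₁ ∘ Ψ) (s, z.2)
  have hC : ContDiff ℝ 1 C := prim _ (hc₁.comp hΨ)
  let g : ℝ × ℝ → ℝ := fun z => Real.exp (C z) * (f₁ ∘ Ψ) z
  have hg : ContDiff ℝ 1 g := hC.exp.mul (hf₁.comp hΨ)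
  -- Variation of constants along each characteristic, with value 0 at time t₀.
  let B : ℝ × ℝ → ℝ := fun z => Real.exp (-C z) * ∫ s in t₀..z.1, g (s, z.2)
  have hB : ContDiff ℝ 1 B := hC.neg.exp.mul (prim _ hg)
  have hBt : ∀ t x, HasDerivAt (fun t => B (t, x)) (f₁ (Ψ (t, x)) - c₁ (Ψ (t, x)) * B (t, x)) t := by
    intro t x
    have h1 := (primd _ (hc₁.comp hΨ) t x).neg.exp.mul (primd _ hg t x)
    refine h1.congr_deriv ?_
    have h2 : Real.exp (-C (t, x)) * Real.exp (C (t, x)) = 1 := by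
      rw [← Real.exp_add]; simp
    simp only [Pi.neg_apply, Function.comp_apply, g, B, C] at h2 ⊢
    linear_combination f₁ (Ψ (t, x)) * h2
  have hΨt : ∀ t x, HasDerivAt (fun t => Ψ (t, x)) (1, v₁ (Ψ (t, x))) t := fun t x =>
    (hasDerivAt_id t).prodMk (hΦt t x)
  have hΨx : ∀ t x, HasDerivAt (fun x => Ψ (t, x)) (0, J t x) x := fun t x =>
    (hasDerivAt_const x t).prodMk (hΦx t x)
  have hp : Ψ (t₀, x₀) = (t₀, x₀) := by simp [Ψ, hΦ0]
  have hJ0 : J t₀ x₀ = 1 := by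
    have h1 := hΦx t₀ x₀
    have h2 : Φ t₀ = id := funext hΦ0
    rw [h2] at h1
    exact h1.unique (hasDerivAt_id x₀)
  let a := v₁ (t₀, x₀)
  -- The differential of Ψ at the base point is the shear (t, x) ↦ (t, a t + x), because Φ is the
  -- identity at time t₀. It is invertible, so the inverse function theorem applies.
  let D : (ℝ × ℝ) ≃L[ℝ] (ℝ × ℝ) := ContinuousLinearEquiv.equivOfInverse
    ((ContinuousLinearMap.fst ℝ ℝ ℝ).prod
      (a • ContinuousLinearMap.fst ℝ ℝ ℝ + ContinuousLinearMap.snd ℝ ℝ ℝ))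
    ((ContinuousLinearMap.fst ℝ ℝ ℝ).prod
      (-a • ContinuousLinearMap.fst ℝ ℝ ℝ + ContinuousLinearMap.snd ℝ ℝ ℝ))
    (fun z => by simp) (fun z => by simp)
  have hΨd : ∀ z, HasFDerivAt Ψ (fderiv ℝ Ψ z) z := fun z =>
    (hΨ.differentiable one_ne_zero z).hasFDerivAt
  have hΨt' : ∀ t x, fderiv ℝ Ψ (t, x) (1, 0) = (1, v₁ (Ψ (t, x))) := fun t x =>
    ((hΨd (t, x)).comp_hasDerivAt (f := fun s => (s, x)) t ((hasDerivAt_id t).prodMk (hasDerivAt_const t x))).unique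
      (hΨt t x)
  have hΨx' : ∀ t x, fderiv ℝ Ψ (t, x) (0, 1) = (0, J t x) := fun t x =>
    ((hΨd (t, x)).comp_hasDerivAt (f := fun s => (t, s)) x ((hasDerivAt_const x t).prodMk (hasDerivAt_id x))).unique
      (hΨx t x)
  have hD : HasFDerivAt Ψ (D : ℝ × ℝ →L[ℝ] ℝ × ℝ) (t₀, x₀) := by
    refine (hΨd (t₀, x₀)).congr_fderiv ?_
    ext
    · simp [hΨt', D]
    · simp [hΨt', D, hp, a]
    · simp [hΨx', D]
    · simp [hΨx', D, hJ0]
  have hΨ0 : ContDiffAt ℝ 1 Ψ (t₀, x₀) := hΨ.contDiffAt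
  let e := hΨ0.toOpenPartialHomeomorph Ψ hD one_ne_zero
  have he : ⇑e = Ψ := rfl
  have hesrc : (t₀, x₀) ∈ e.source := hΨ0.mem_toOpenPartialHomeomorph_source hD one_ne_zero
  have hetgt : (t₀, x₀) ∈ e.target := by
    have := e.map_source hesrc
    rwa [he, hp] at this
  have hes : e.symm (t₀, x₀) = (t₀, x₀) := by
    have := e.left_inv hesrc
    rwa [he, hp] at this
  have hesd : ContDiffAt ℝ 1 e.symm (t₀, x₀) := by
    have := hΨ0.to_localInverse hD one_ne_zero
    rw [hp] at this
    exact this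
  have hA : ContDiffAt ℝ 1 (B ∘ e.symm) (t₀, x₀) := hB.contDiffAt.comp _ hesd
  refine ⟨B ∘ e.symm, hA, ?_⟩
  filter_upwards [e.open_target.mem_nhds hetgt, hA.eventually (by simp), hv₁e, hc₁e, hf₁e]
    with y hy hyA hyv hyc hyf
  obtain ⟨⟨t, x⟩, hz⟩ : ∃ w, e.symm y = w := ⟨_, rfl⟩
  have hzy : Ψ (t, x) = y := by rw [← hz, ← he]; exact e.right_inv hy
  -- For s near t the point (s, x) stays in the domain where Ψ is inverted. Differentiating this
  -- identity in s turns the derivative of A along (1, v) into the t-derivative of B.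
  have hAB : (fun s => (B ∘ e.symm) (Ψ (s, x))) =ᶠ[𝓝 t] fun s => B (s, x) := by
    have hmem : (t, x) ∈ e.source := by rw [← hz]; exact e.map_target hy
    have hcont : ContinuousAt (fun s : ℝ => (s, x)) t := by fun_prop
    filter_upwards [hcont.preimage_mem_nhds (e.open_source.mem_nhds hmem)] with s hs
    have := e.left_inv hs
    rw [he] at this
    simp [this]
  have h1 := ((hyA.differentiableAt one_ne_zero).hasFDerivAt.comp_hasDerivAt_of_eq t (hΨt t x)
    hzy.symm).congr_of_eventuallyEq hAB.symm
  have h2 := h1.unique (hBt t x)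
  rw [hzy] at h2
  rw [← hyv, h2, ← hyc, ← hyf, Function.comp_apply, hz]
  ring

end Transport

noncomputable section

namespace Spacetime2

open Filter

/-! ### Partial derivatives -/

theorem partialDeriv_congr {f g : Coord → ℝ} {y : Coord} (c : Fin 2) (h : f =ᶠ[𝓝 y] g) :
    partialDeriv c f y = partialDeriv c g y := by
  rw [partialDeriv, h.fderiv_eq, partialDeriv]

@[simp]
theorem partialDeriv_const (c : Fin 2) (r : ℝ) (y : Coord) :
    partialDeriv c (fun _ => r) y = 0 := by
  simp [partialDeriv]

theorem partialDeriv_add {f g : Coord → ℝ} {y : Coord} (c : Fin 2) (hf : DifferentiableAt ℝ f y)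
    (hg : DifferentiableAt ℝ g y) :
    partialDeriv c (fun z => f z + g z) y = partialDeriv c f y + partialDeriv c g y := by
  simp only [partialDeriv]
  rw [fderiv_fun_add hf hg]
  simp

theorem partialDeriv_mul {f g : Coord → ℝ} {y : Coord} (c : Fin 2) (hf : DifferentiableAt ℝ f y)
    (hg : DifferentiableAt ℝ g y) :
    partialDeriv c (fun z => f z * g z) y
      = partialDeriv c f y * g y + f y * partialDeriv c g y := by
  simp only [partialDeriv]
  rw [fderiv_fun_mul hf hg]
  simp
  ring

theorem partialDeriv_sum {f : Fin 2 → Coord → ℝ} {y : Coord} (c : Fin 2)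
    (hf : ∀ i, DifferentiableAt ℝ (f i) y) :
    partialDeriv c (fun z => ∑ i, f i z) y = ∑ i, partialDeriv c (f i) y := by
  simp only [Fin.sum_univ_two]
  exact partialDeriv_add c (hf 0) (hf 1)

theorem fderiv_apply_eq_sum (f : Coord → ℝ) (y v : Coord) :
    fderiv ℝ f y v = ∑ k, partialDeriv k f y * v k := by
  have hv : v = v 0 • EuclideanSpace.single 0 1 + v 1 • EuclideanSpace.single 1 1 := by
    ext i; fin_cases i <;> simp
  conv_lhs => rw [hv]
  simp [partialDeriv, Fin.sum_univ_two, mul_comm]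

/-- The Jacobian matrix `∂φⁱ/∂xᵃ`. -/
def jac (φ : Coord → Coord) (y : Coord) : Matrix (Fin 2) (Fin 2) ℝ :=
  Matrix.of fun i a => partialDeriv a (fun z => φ z i) y

theorem partialDeriv_comp {f : Coord → ℝ} {φ : Coord → Coord} {y : Coord} (c : Fin 2)
    (hf : DifferentiableAt ℝ f (φ y)) (hφ : DifferentiableAt ℝ φ y) :
    partialDeriv c (fun z => f (φ z)) y = ∑ k, partialDeriv k f (φ y) * jac φ y k c := by
  change fderiv ℝ (f ∘ φ) y _ = _
  rw [fderiv_comp y hf hφ, ContinuousLinearMap.comp_apply, fderiv_apply_eq_sum]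
  refine Finset.sum_congr rfl fun k _ => ?_
  have hk : HasFDerivAt (fun z => φ z k) ((EuclideanSpace.proj k : Coord →L[ℝ] ℝ).comp
    (fderiv ℝ φ y)) y := (EuclideanSpace.proj k : Coord →L[ℝ] ℝ).hasFDerivAt.comp y hφ.hasFDerivAt
  simp only [jac, Matrix.of_apply, partialDeriv, hk.fderiv]
  rfl

theorem contDiffAt_partialDeriv {f : Coord → ℝ} {y : Coord} {m n : WithTop ℕ∞} (c : Fin 2)
    (hf : ContDiffAt ℝ n f y) (hmn : m + 1 ≤ n) : ContDiffAt ℝ m (partialDeriv c f) y :=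
  (hf.fderiv_right hmn).clm_apply contDiffAt_const

theorem partialDeriv_comm {f : Coord → ℝ} {y : Coord} (hf : ContDiffAt ℝ 2 f y) (a b : Fin 2) :
    partialDeriv a (partialDeriv b f) y = partialDeriv b (partialDeriv a f) y := by
  have key : ∀ a b, partialDeriv a (partialDeriv b f) y =
      fderiv ℝ (fderiv ℝ f) y (EuclideanSpace.single a 1) (EuclideanSpace.single b 1) := by
    intro a b
    have h1 : DifferentiableAt ℝ (fderiv ℝ f) y :=
      (hf.fderiv_right (m := 1) (by norm_num)).differentiableAt (by simp)
    have h2 := h1.hasFDerivAt.clm_apply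
      (hasFDerivAt_const (EuclideanSpace.single b (1 : ℝ) : Coord) y)
    change fderiv ℝ (fun z => fderiv ℝ f z (EuclideanSpace.single b 1)) y _ = _
    rw [h2.fderiv]
    simp
  rw [key, key]
  exact (hf.isSymmSndFDerivAt (by simp)) _ _

theorem contDiffAt_apply {φ : Coord → Coord} {y : Coord} {n : WithTop ℕ∞}
    (hφ : ContDiffAt ℝ n φ y) (i : Fin 2) : ContDiffAt ℝ n (fun z => φ z i) y :=
  (EuclideanSpace.proj i : Coord →L[ℝ] ℝ).contDiff.contDiffAt.comp y hφ

theorem contDiffAt_jac {φ : Coord → Coord} {y : Coord} {m n : WithTop ℕ∞}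
    (hφ : ContDiffAt ℝ n φ y) (hmn : m + 1 ≤ n) (i a : Fin 2) :
    ContDiffAt ℝ m (fun z => jac φ z i a) y :=
  contDiffAt_partialDeriv a (contDiffAt_apply hφ i) hmn

/-- Symmetry of the Hessian of φ, which makes the non-tensorial terms cancel in the transformation
laws. -/
theorem partialDeriv_jac_comm {φ : Coord → Coord} {y : Coord} (hφ : ContDiffAt ℝ 2 φ y)
    (i a b : Fin 2) :
    partialDeriv a (fun z => jac φ z i b) y = partialDeriv b (fun z => jac φ z i a) y :=
  partialDeriv_comm (contDiffAt_apply hφ i) a b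

/-- Local solvability of linear transport equations `∂₀A + v ∂₁A + c A = f` in the class `C¹`. -/
theorem exists_transport_solution {v c f : Coord → ℝ} {p : Coord} (hv : ContDiffAt ℝ 1 v p)
    (hc : ContDiffAt ℝ 1 c p) (hf : ContDiffAt ℝ 1 f p) :
    ∃ A : Coord → ℝ, ContDiffAt ℝ 1 A p ∧
      ∀ᶠ y in 𝓝 p, partialDeriv 0 A y + v y * partialDeriv 1 A y + c y * A y = f y := by
  let pr : Coord →L[ℝ] ℝ × ℝ :=
    (EuclideanSpace.proj 0 : Coord →L[ℝ] ℝ).prod (EuclideanSpace.proj 1)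
  let s : ℝ × ℝ → Coord := fun z => z.1 • EuclideanSpace.single 0 1 + z.2 • EuclideanSpace.single 1 1
  have hs : ContDiff ℝ 1 s := by fun_prop
  have hsp : ∀ y, s (pr y) = y := by
    intro y
    ext i
    fin_cases i <;> simp [s, pr]
  have tr : ∀ g : Coord → ℝ, ContDiffAt ℝ 1 g p → ContDiffAt ℝ 1 (g ∘ s) (pr p) := by
    intro g hg
    rw [← hsp p] at hg
    exact hg.comp _ hs.contDiffAt
  obtain ⟨A, hA, hAe⟩ := _root_.exists_transport_solution (tr v hv) (tr c hc) (tr f hf)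
  refine ⟨A ∘ pr, hA.comp p pr.contDiff.contDiffAt, ?_⟩
  filter_upwards [pr.continuous.continuousAt.eventually hAe,
    pr.continuous.continuousAt.eventually (hA.eventually (by simp))] with y hy hyA
  simp only [Function.comp_apply, hsp] at hy
  have h1 := ((hyA.differentiableAt one_ne_zero).hasFDerivAt.comp y pr.hasFDerivAt)
  simp only [partialDeriv, h1.fderiv, ContinuousLinearMap.comp_apply]
  have e0 : pr (EuclideanSpace.single 0 1) = (1, 0) := by simp [pr]
  have e1 : pr (EuclideanSpace.single 1 1) = (0, 1) := by simp [pr]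
  have e2 : ((1 : ℝ), v y) = (1, 0) + v y • (0, 1) := by simp
  rw [e2, map_add, map_smul, smul_eq_mul] at hy
  rw [e0, e1, Function.comp_apply]
  exact hy

end Spacetime2

end

noncomputable section

namespace Spacetime2

open Filter

/-! ### Christoffel symbols -/

/-- The Christoffel symbol `Γ_{dbc}` with all indices lowered. -/
def lowChristoffel (h : Coord → Matrix (Fin 2) (Fin 2) ℝ) (d b c : Fin 2) (y : Coord) : ℝ :=
  (1 / 2) * (partialDeriv b (fun z => h z d c) y + partialDeriv c (fun z => h z d b) y
      - partialDeriv d (fun z => h z b c) y)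

theorem christoffel_eq (h : Coord → Matrix (Fin 2) (Fin 2) ℝ) (a b c : Fin 2) (y : Coord) :
    christoffel h a b c y = ∑ d, (h y)⁻¹ a d * lowChristoffel h d b c y := by
  simp only [christoffel, lowChristoffel, Fin.sum_univ_two]
  ring

theorem sum_mul_christoffel {h : Coord → Matrix (Fin 2) (Fin 2) ℝ} {y : Coord}
    (hd : (h y).det ≠ 0) (e b c : Fin 2) :
    ∑ a, h y e a * christoffel h a b c y = lowChristoffel h e b c y := by
  have h1 : h y * (h y)⁻¹ = 1 := Matrix.mul_nonsing_inv _ hd.isUnit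
  have h2 : (fun a => christoffel h a b c y) =
      (h y)⁻¹.mulVec fun d => lowChristoffel h d b c y :=
    funext fun a => christoffel_eq h a b c y
  change ((h y).mulVec fun a => christoffel h a b c y) e = _
  rw [h2, Matrix.mulVec_mulVec, h1, Matrix.one_mulVec]

theorem christoffel_symm {h : Coord → Matrix (Fin 2) (Fin 2) ℝ} (hs : ∀ z, (h z).IsSymm)
    (a b c : Fin 2) (y : Coord) : christoffel h a b c y = christoffel h a c b y := by
  have h1 : (fun z => h z b c) = fun z => h z c b := funext fun z => (hs z).apply c b
  simp only [christoffel, h1]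
  congr 1
  refine Finset.sum_congr rfl fun d _ => ?_
  ring

/-- Metric compatibility, ∇g = 0: adding two lowered Christoffel symbols cancels all but one
derivative of the metric. -/
theorem partialDeriv_metric {h : Coord → Matrix (Fin 2) (Fin 2) ℝ} {y : Coord}
    (hs : ∀ z, (h z).IsSymm) (hd : (h y).det ≠ 0) (c a b : Fin 2) :
    partialDeriv c (fun z => h z a b) y = ∑ d, h y a d * christoffel h d c b y
      + ∑ d, h y b d * christoffel h d c a y := by
  have h1 : ∀ i j, (fun z => h z i j) = fun z => h z j i :=
    fun i j => funext fun z => (hs z).apply j i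
  rw [sum_mul_christoffel hd, sum_mul_christoffel hd, lowChristoffel, lowChristoffel, h1 b a,
    h1 c b, h1 c a]
  ring

/-- `h'` is the pullback of `h` by `φ` near `y`, as a covariant tensor field. -/
def IsPullback (φ : Coord → Coord) (h h' : Coord → Matrix (Fin 2) (Fin 2) ℝ) (y : Coord) : Prop :=
  ∀ᶠ z in 𝓝 y, h' z = (jac φ z).transpose * h (φ z) * jac φ z

section Pullback

variable {φ : Coord → Coord} {h h' : Coord → Matrix (Fin 2) (Fin 2) ℝ} {y : Coord}

theorem IsPullback.eventually (H : IsPullback φ h h' y) : ∀ᶠ z in 𝓝 y, IsPullback φ h h' z :=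
  H.eventually_nhds

theorem IsPullback.eq (H : IsPullback φ h h' y) :
    h' y = (jac φ y).transpose * h (φ y) * jac φ y :=
  H.self_of_nhds

theorem IsPullback.apply (H : IsPullback φ h h' y) (a b : Fin 2) :
    (fun z => h' z a b) =ᶠ[𝓝 y]
      fun z => ∑ i, ∑ j, jac φ z i a * h (φ z) i j * jac φ z j b := by
  filter_upwards [H] with z hz
  simp only [hz, Matrix.mul_apply, Matrix.transpose_apply, Fin.sum_univ_two]
  ring

theorem IsPullback.partialDeriv_eq (H : IsPullback φ h h' y) (hφ : ContDiffAt ℝ 2 φ y)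
    (hh : ∀ i j, DifferentiableAt ℝ (fun z => h z i j) (φ y)) (c a b : Fin 2) :
    partialDeriv c (fun z => h' z a b) y = ∑ i, ∑ j,
      (partialDeriv c (fun z => jac φ z i a) y * h (φ y) i j * jac φ y j b
        + jac φ y i a * (∑ k, partialDeriv k (fun z => h z i j) (φ y) * jac φ y k c) * jac φ y j b
        + jac φ y i a * h (φ y) i j * partialDeriv c (fun z => jac φ z j b) y) := by
  have hφ1 : DifferentiableAt ℝ φ y := hφ.differentiableAt (by norm_num)
  have hJ : ∀ i a, DifferentiableAt ℝ (fun z => jac φ z i a) y := fun i a =>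
    (contDiffAt_jac (m := 1) hφ (by norm_num) i a).differentiableAt (by norm_num)
  have hhφ : ∀ i j, DifferentiableAt ℝ (fun z => h (φ z) i j) y := fun i j =>
    DifferentiableAt.comp (g := fun z => h z i j) y (hh i j) hφ1
  rw [partialDeriv_congr c (H.apply a b), partialDeriv_sum]
  · refine Finset.sum_congr rfl fun i _ => ?_
    rw [partialDeriv_sum]
    · refine Finset.sum_congr rfl fun j _ => ?_
      rw [partialDeriv_mul c ((hJ i a).fun_mul (hhφ i j)) (hJ j b),
        partialDeriv_mul c (hJ i a) (hhφ i j), partialDeriv_comp (f := fun z => h z i j) c (hh i j) hφ1]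
      ring
    · exact fun j => ((hJ i a).fun_mul (hhφ i j)).fun_mul (hJ j b)
  · intro i
    exact DifferentiableAt.fun_sum fun j _ => ((hJ i a).fun_mul (hhφ i j)).fun_mul (hJ j b)

/-- Of the second derivatives of φ produced by the three terms, symmetry cancels all but those in
the directions b and c. Working with lowered indices avoids the inverse metric. -/
theorem IsPullback.lowChristoffel_eq (H : IsPullback φ h h' y) (hφ : ContDiffAt ℝ 2 φ y)
    (hs : ∀ z, (h z).IsSymm)
    (hh : ∀ i j, DifferentiableAt ℝ (fun z => h z i j) (φ y)) (d b c : Fin 2) :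
    lowChristoffel h' d b c y = ∑ i, jac φ y i d *
      ((∑ j, ∑ k, lowChristoffel h i j k (φ y) * jac φ y j b * jac φ y k c)
        + ∑ j, h (φ y) i j * partialDeriv b (fun z => jac φ z j c) y) := by
  have hc := partialDeriv_jac_comm hφ
  have h1 : (fun z => h z 1 0) = fun z => h z 0 1 := funext fun z => (hs z).apply 0 1
  have h2 : h (φ y) 1 0 = h (φ y) 0 1 := (hs _).apply 0 1
  rw [lowChristoffel, H.partialDeriv_eq hφ hh, H.partialDeriv_eq hφ hh, H.partialDeriv_eq hφ hh]
  simp only [lowChristoffel, Fin.sum_univ_two, h1, h2]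
  rw [hc 0 b d, hc 1 b d, hc 0 c d, hc 1 c d, hc 0 b c, hc 1 b c]
  ring

theorem IsPullback.det_ne_zero (H : IsPullback φ h h' y) (hd : (h (φ y)).det ≠ 0)
    (hJ : (jac φ y).det ≠ 0) : (h' y).det ≠ 0 := by
  rw [H.eq, Matrix.det_mul, Matrix.det_mul, Matrix.det_transpose]
  exact mul_ne_zero (mul_ne_zero hJ hd) hJ

theorem IsPullback.mul_inv_mul (H : IsPullback φ h h' y)
    (hJ : (jac φ y).det ≠ 0) : jac φ y * (h' y)⁻¹ * (jac φ y).transpose = (h (φ y))⁻¹ := by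
  have h1 : jac φ y * (jac φ y)⁻¹ = 1 := Matrix.mul_nonsing_inv _ hJ.isUnit
  have h2 : (jac φ y).transpose⁻¹ * (jac φ y).transpose = 1 :=
    Matrix.nonsing_inv_mul _ (by rw [Matrix.det_transpose]; exact hJ.isUnit)
  rw [H.eq, Matrix.mul_inv_rev, Matrix.mul_inv_rev, ← Matrix.mul_assoc, h1, Matrix.one_mul,
    Matrix.mul_assoc, h2, Matrix.mul_one]

/-- The transformation law of the Christoffel symbols. -/
theorem IsPullback.christoffel_eq (H : IsPullback φ h h' y) (hφ : ContDiffAt ℝ 2 φ y)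
    (hs : ∀ z, (h z).IsSymm) (hd : (h (φ y)).det ≠ 0) (hJ : (jac φ y).det ≠ 0)
    (hh : ∀ i j, DifferentiableAt ℝ (fun z => h z i j) (φ y)) (i b c : Fin 2) :
    ∑ a, jac φ y i a * christoffel h' a b c y =
      (∑ j, ∑ k, christoffel h i j k (φ y) * jac φ y j b * jac φ y k c)
        + partialDeriv b (fun z => jac φ z i c) y := by
  -- Multiplication by Jᵀh is injective and lowers the free index, which reduces the claim to the
  -- law for lowered symbols.
  have hM : IsUnit ((jac φ y).transpose * h (φ y)) := by
    rw [Matrix.isUnit_iff_isUnit_det, Matrix.det_mul, Matrix.det_transpose]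
    exact (mul_ne_zero hJ hd).isUnit
  have hinj := Matrix.mulVec_injective_of_isUnit hM
  have key : (jac φ y).mulVec (fun a => christoffel h' a b c y) = fun i =>
      (∑ j, ∑ k, christoffel h i j k (φ y) * jac φ y j b * jac φ y k c)
        + partialDeriv b (fun z => jac φ z i c) y := by
    apply hinj
    rw [Matrix.mulVec_mulVec, ← H.eq]
    funext e
    have e1 := sum_mul_christoffel (h := h') (H.det_ne_zero hd hJ) e b c
    have e2 := fun l j k => sum_mul_christoffel hd (h := h) (y := φ y) l j k
    simp only [Matrix.mulVec, dotProduct] at e1 e2 ⊢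
    rw [e1, H.lowChristoffel_eq hφ hs hh]
    simp only [← e2, Matrix.mul_apply, Matrix.transpose_apply, Fin.sum_univ_two]
    ring
  exact congrFun key i

end Pullback

end Spacetime2

end

noncomputable section

namespace Spacetime2

open Filter

/-! ### Regularity of the Christoffel symbols and of the curvature -/

section Regularity

variable {h : Coord → Matrix (Fin 2) (Fin 2) ℝ} {y : Coord} {m n : WithTop ℕ∞}

theorem contDiffAt_det (hh : ∀ i j, ContDiffAt ℝ n (fun z => h z i j) y) :
    ContDiffAt ℝ n (fun z => (h z).det) y := by
  simp only [Matrix.det_fin_two]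
  exact ((hh 0 0).mul (hh 1 1)).sub ((hh 0 1).mul (hh 1 0))

theorem inv_apply_fin_two (A : Matrix (Fin 2) (Fin 2) ℝ) (a b : Fin 2) :
    A⁻¹ a b = (A.det)⁻¹ * !![A 1 1, -A 0 1; -A 1 0, A 0 0] a b := by
  rw [Matrix.inv_def, Matrix.adjugate_fin_two, Ring.inverse_eq_inv', Matrix.smul_apply, smul_eq_mul]

theorem contDiffAt_inv (hh : ∀ i j, ContDiffAt ℝ n (fun z => h z i j) y) (hd : (h y).det ≠ 0)
    (a b : Fin 2) : ContDiffAt ℝ n (fun z => (h z)⁻¹ a b) y := by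
  simp only [inv_apply_fin_two]
  refine ((contDiffAt_det hh).inv hd).mul ?_
  fin_cases a <;> fin_cases b
  · exact hh 1 1
  · exact (hh 0 1).neg
  · exact (hh 1 0).neg
  · exact hh 0 0

theorem contDiffAt_christoffel (hh : ∀ i j, ContDiffAt ℝ n (fun z => h z i j) y)
    (hd : (h y).det ≠ 0) (hmn : m + 1 ≤ n) (a b c : Fin 2) :
    ContDiffAt ℝ m (christoffel h a b c) y := by
  have hp : ∀ i j k, ContDiffAt ℝ m (partialDeriv k fun z => h z i j) y := fun i j k =>
    contDiffAt_partialDeriv k (hh i j) hmn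
  have hi : ∀ i j, ContDiffAt ℝ m (fun z => (h z)⁻¹ i j) y := fun i j =>
    (contDiffAt_inv hh hd i j).of_le (le_self_add.trans hmn)
  unfold christoffel
  exact contDiffAt_const.mul (ContDiffAt.sum fun d _ =>
    (hi a d).mul (((hp d c b).add (hp d b c)).sub (hp b c d)))

theorem contDiffAt_ricciScalar (hh : ∀ i j, ContDiffAt ℝ n (fun z => h z i j) y)
    (hd : (h y).det ≠ 0) (hmn : m + 1 + 1 ≤ n) : ContDiffAt ℝ m (ricciScalar h) y := by
  have hΓ' : ∀ a b c, ContDiffAt ℝ (m + 1) (christoffel h a b c) y :=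
    contDiffAt_christoffel hh hd hmn
  have hΓ : ∀ a b c, ContDiffAt ℝ m (christoffel h a b c) y := fun a b c =>
    (hΓ' a b c).of_le le_self_add
  have hp : ∀ a b c d, ContDiffAt ℝ m (partialDeriv d (christoffel h a b c)) y := fun a b c d =>
    contDiffAt_partialDeriv d (hΓ' a b c) le_rfl
  have hi : ∀ i j, ContDiffAt ℝ m (fun z => (h z)⁻¹ i j) y := fun i j =>
    (contDiffAt_inv hh hd i j).of_le ((le_self_add.trans le_self_add).trans hmn)
  unfold ricciScalar ricci riemann
  refine ContDiffAt.sum fun b _ => ContDiffAt.sum fun d _ => ContDiffAt.mul ?_ (hi b d)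
  exact ContDiffAt.sum fun a _ => (((hp _ _ _ _).sub (hp _ _ _ _)).add
    (ContDiffAt.sum fun f _ => (hΓ _ _ _).mul (hΓ _ _ _))).sub
    (ContDiffAt.sum fun f _ => (hΓ _ _ _).mul (hΓ _ _ _))

end Regularity

/-! ### Transformation laws of the curvature and of the divergence -/

section Pullback

variable {φ : Coord → Coord} {h h' : Coord → Matrix (Fin 2) (Fin 2) ℝ} {y : Coord}

theorem IsPullback.partialDeriv_christoffel (H : IsPullback φ h h' y) (hφ : ContDiffAt ℝ 3 φ y)
    (hs : ∀ z, (h z).IsSymm) (hd : (h (φ y)).det ≠ 0) (hJ : (jac φ y).det ≠ 0)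
    (hh : ∀ i j, ContDiffAt ℝ 2 (fun z => h z i j) (φ y))
    (hh' : ∀ i j, ContDiffAt ℝ 2 (fun z => h' z i j) y) (i b c d : Fin 2) :
    ∑ a, (partialDeriv d (fun z => jac φ z i a) y * christoffel h' a b c y
        + jac φ y i a * partialDeriv d (christoffel h' a b c) y) =
      (∑ j, ∑ k,
        ((∑ l, partialDeriv l (christoffel h i j k) (φ y) * jac φ y l d)
            * jac φ y j b * jac φ y k c
          + christoffel h i j k (φ y) * partialDeriv d (fun z => jac φ z j b) y * jac φ y k c
          + christoffel h i j k (φ y) * jac φ y j b * partialDeriv d (fun z => jac φ z k c) y))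
      + partialDeriv d (partialDeriv b (fun z => jac φ z i c)) y := by
  have hφc : ContinuousAt φ y := hφ.continuousAt
  have hφ1 : DifferentiableAt ℝ φ y := hφ.differentiableAt (by norm_num)
  have hJ2 : ∀ i a, ContDiffAt ℝ 2 (fun z => jac φ z i a) y :=
    contDiffAt_jac hφ (by norm_num)
  have hJd : ∀ i a, DifferentiableAt ℝ (fun z => jac φ z i a) y := fun i a =>
    (hJ2 i a).differentiableAt (by norm_num)
  have hΓ : ∀ i j k, DifferentiableAt ℝ (christoffel h i j k) (φ y) := fun i j k =>
    (contDiffAt_christoffel (m := 1) hh hd (by norm_num) i j k).differentiableAt (by norm_num)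
  have hΓφ : ∀ i j k, DifferentiableAt ℝ (fun z => christoffel h i j k (φ z)) y := fun i j k =>
    (hΓ i j k).comp y hφ1
  have hΓ' : ∀ i j k, DifferentiableAt ℝ (christoffel h' i j k) y := fun i j k =>
    (contDiffAt_christoffel (m := 1) hh' (H.det_ne_zero hd hJ) (by norm_num) i j k).differentiableAt
      (by norm_num)
  have hdJ : DifferentiableAt ℝ (partialDeriv b (fun z => jac φ z i c)) y :=
    (contDiffAt_partialDeriv (m := 1) b (hJ2 i c) (by norm_num)).differentiableAt (by norm_num)
  -- The hypotheses at y are open conditions, so the Christoffel law holds on a neighbourhood and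
  -- may be differentiated.
  have hev : (fun z => ∑ a, jac φ z i a * christoffel h' a b c z) =ᶠ[𝓝 y] fun z =>
      (∑ j, ∑ k, christoffel h i j k (φ z) * jac φ z j b * jac φ z k c)
        + partialDeriv b (fun z => jac φ z i c) z := by
    have e1 : ∀ᶠ z in 𝓝 y, (h (φ z)).det ≠ 0 :=
      hφc.eventually ((contDiffAt_det hh).continuousAt.eventually_ne hd)
    have e2 : ∀ᶠ z in 𝓝 y, (jac φ z).det ≠ 0 :=
      (contDiffAt_det hJ2).continuousAt.eventually_ne hJ
    have e3 : ∀ᶠ z in 𝓝 y, ∀ i j, ContDiffAt ℝ 2 (fun z => h z i j) (φ z) :=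
      hφc.eventually (eventually_all.2 fun i => eventually_all.2 fun j =>
        (hh i j).eventually (by simp))
    filter_upwards [H.eventually, hφ.eventually (by simp), e1, e2, e3] with z z1 z2 z3 z4 z5
    exact z1.christoffel_eq (z2.of_le (by norm_num)) hs z3 z4
      (fun i j => (z5 i j).differentiableAt (by norm_num)) i b c
  have hpd := partialDeriv_congr d hev
  have hterm : ∀ j k, DifferentiableAt ℝ
      (fun z => christoffel h i j k (φ z) * jac φ z j b * jac φ z k c) y := fun j k =>
    ((hΓφ i j k).fun_mul (hJd j b)).fun_mul (hJd k c)
  rw [partialDeriv_sum d fun a => (hJd i a).fun_mul (hΓ' a b c),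
    partialDeriv_add d (DifferentiableAt.fun_sum fun j _ => DifferentiableAt.fun_sum fun k _ =>
      hterm j k) hdJ,
    partialDeriv_sum d fun j => DifferentiableAt.fun_sum fun k _ => hterm j k] at hpd
  rw [Finset.sum_congr rfl fun a _ => (partialDeriv_mul d (hJd i a) (hΓ' a b c)).symm, hpd]
  congr 1
  refine Finset.sum_congr rfl fun j _ => ?_
  rw [partialDeriv_sum d fun k => hterm j k]
  refine Finset.sum_congr rfl fun k _ => ?_
  rw [partialDeriv_mul d ((hΓφ i j k).fun_mul (hJd j b)) (hJd k c),
    partialDeriv_mul d (hΓφ i j k) (hJd j b), partialDeriv_comp d (hΓ i j k) hφ1]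
  ring

/-- The transformation law of the Riemann tensor. -/
theorem IsPullback.riemann_eq (H : IsPullback φ h h' y) (hφ : ContDiffAt ℝ 3 φ y)
    (hs : ∀ z, (h z).IsSymm) (hd : (h (φ y)).det ≠ 0) (hJ : (jac φ y).det ≠ 0)
    (hh : ∀ i j, ContDiffAt ℝ 2 (fun z => h z i j) (φ y))
    (hh' : ∀ i j, ContDiffAt ℝ 2 (fun z => h' z i j) y) (i b c d : Fin 2) :
    ∑ a, jac φ y i a * riemann h' a b c d y =
      ∑ j, ∑ k, ∑ l, riemann h i j k l (φ y) * jac φ y j b * jac φ y k c * jac φ y l d := by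
  have hφ2 : ContDiffAt ℝ 2 φ y := hφ.of_le (by norm_num)
  have C := H.christoffel_eq hφ2 hs hd hJ fun i j => (hh i j).differentiableAt (by norm_num)
  have D1 := H.partialDeriv_christoffel hφ hs hd hJ hh hh' i b d c
  have D2 := H.partialDeriv_christoffel hφ hs hd hJ hh hh' i b c d
  have hc := partialDeriv_jac_comm hφ2
  -- The third derivatives of φ are symmetric, so they drop out of the antisymmetrization in c and
  -- d.
  have hcc : partialDeriv c (partialDeriv b (fun z => jac φ z i d)) y =
      partialDeriv d (partialDeriv b (fun z => jac φ z i c)) y := by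
    have hev : ∀ a b, partialDeriv a (fun z => jac φ z i b) =ᶠ[𝓝 y]
        partialDeriv b (fun z => jac φ z i a) := fun a b =>
      (hφ2.eventually (by simp)).mono fun z hz => partialDeriv_jac_comm hz i a b
    rw [partialDeriv_congr c (hev b d), partialDeriv_comm (contDiffAt_jac hφ (by norm_num) i b) c d,
      partialDeriv_congr d (hev c b)]
  have hΓ : ∀ a, christoffel h a 1 0 (φ y) = christoffel h a 0 1 (φ y) := fun a =>
    christoffel_symm hs a 1 0 (φ y)
  rw [hcc] at D1
  have C00 := C i c 0
  have C01 := C i c 1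
  have C10 := C i d 0
  have C11 := C i d 1
  have E00 := C 0 b d
  have E01 := C 1 b d
  have E10 := C 0 b c
  have E11 := C 1 b c
  simp only [riemann, Fin.sum_univ_two, hΓ] at D1 D2 C00 C01 C10 C11 E00 E01 E10 E11 ⊢
  rw [hc 0 b d] at E00
  rw [hc 1 b d] at E01
  rw [hc 0 b c] at E10
  rw [hc 1 b c] at E11
  rw [hc 0 c d, hc 1 c d] at D1
  -- D1 - D2 gives the derivative part of the curvature. The C terms trade the products of second
  -- derivatives of φ with Γ' for the quadratic part Γ'Γ'; the E terms then rewrite the remaining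
  -- mixed products of Γ and Γ', cancelling the other second derivatives.
  linear_combination D1 - D2 + christoffel h' 0 b d y * C00 + christoffel h' 1 b d y * C01
    - christoffel h' 0 b c y * C10 - christoffel h' 1 b c y * C11
    + (christoffel h i 0 0 (φ y) * jac φ y 0 c + christoffel h i 0 1 (φ y) * jac φ y 1 c) * E00
    + (christoffel h i 0 1 (φ y) * jac φ y 0 c + christoffel h i 1 1 (φ y) * jac φ y 1 c) * E01
    - (christoffel h i 0 0 (φ y) * jac φ y 0 d + christoffel h i 0 1 (φ y) * jac φ y 1 d) * E10
    - (christoffel h i 0 1 (φ y) * jac φ y 0 d + christoffel h i 1 1 (φ y) * jac φ y 1 d) * E11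

end Pullback

end Spacetime2

end

noncomputable section

namespace Spacetime2

open Filter

section Pullback

variable {φ : Coord → Coord} {h h' : Coord → Matrix (Fin 2) (Fin 2) ℝ} {y : Coord}

theorem IsPullback.ricci_eq (H : IsPullback φ h h' y) (hφ : ContDiffAt ℝ 3 φ y)
    (hs : ∀ z, (h z).IsSymm) (hd : (h (φ y)).det ≠ 0) (hJ : (jac φ y).det ≠ 0)
    (hh : ∀ i j, ContDiffAt ℝ 2 (fun z => h z i j) (φ y))
    (hh' : ∀ i j, ContDiffAt ℝ 2 (fun z => h' z i j) y) (b d : Fin 2) :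
    ricci h' b d y = ∑ j, ∑ l, ricci h j l (φ y) * jac φ y j b * jac φ y l d := by
  have R := H.riemann_eq hφ hs hd hJ hh hh'
  have h1 : (jac φ y)⁻¹ * jac φ y = 1 := Matrix.nonsing_inv_mul _ hJ.isUnit
  have h2 : jac φ y * (jac φ y)⁻¹ = 1 := Matrix.mul_nonsing_inv _ hJ.isUnit
  set J := jac φ y
  set K := J⁻¹
  have k1 : ∀ a c, K a 0 * J 0 c + K a 1 * J 1 c = (1 : Matrix (Fin 2) (Fin 2) ℝ) a c := fun a c => by
    rw [← h1, Matrix.mul_apply, Fin.sum_univ_two]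
  have k2 : ∀ a c, J a 0 * K 0 c + J a 1 * K 1 c = (1 : Matrix (Fin 2) (Fin 2) ℝ) a c := fun a c => by
    rw [← h2, Matrix.mul_apply, Fin.sum_univ_two]
  have r : ∀ a c, riemann h' a b c d y = ∑ i, K a i * ∑ j, ∑ k, ∑ l,
      riemann h i j k l (φ y) * J j b * J k c * J l d := by
    intro a c
    simp only [← R]
    simp only [Fin.sum_univ_two]
    fin_cases a
    · have := k1 0 0
      have := k1 0 1
      simp at *
      grind
    · have := k1 1 0
      have := k1 1 1
      simp at *
      grind
  have m00 : K 0 0 * J 0 0 + K 1 0 * J 0 1 = 1 := by simpa [mul_comm] using k2 0 0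
  have m01 : K 0 0 * J 1 0 + K 1 0 * J 1 1 = 0 := by simpa [mul_comm] using k2 1 0
  have m10 : K 0 1 * J 0 0 + K 1 1 * J 0 1 = 0 := by simpa [mul_comm] using k2 0 1
  have m11 : K 0 1 * J 1 0 + K 1 1 * J 1 1 = 1 := by simpa [mul_comm] using k2 1 1
  simp only [ricci, r]
  simp only [Fin.sum_univ_two]
  -- Contracting a with c pairs the inverse Jacobian on the upper index with J on the third, leaving
  -- the Kronecker deltas `m00` to `m11` against S.
  let S : Fin 2 → Fin 2 → ℝ := fun i k => riemann h i 0 k 0 (φ y) * J 0 b * J 0 d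
    + riemann h i 0 k 1 (φ y) * J 0 b * J 1 d + riemann h i 1 k 0 (φ y) * J 1 b * J 0 d
    + riemann h i 1 k 1 (φ y) * J 1 b * J 1 d
  linear_combination S 0 0 * m00 + S 0 1 * m01 + S 1 0 * m10 + S 1 1 * m11

theorem sum_mul_eq_trace (A B : Matrix (Fin 2) (Fin 2) ℝ) :
    ∑ a, ∑ b, A a b * B a b = (A * B.transpose).trace := by
  simp [Matrix.trace, Matrix.mul_apply]

/-- The Ricci scalar is invariant under changes of coordinates. -/
theorem IsPullback.ricciScalar_eq (H : IsPullback φ h h' y) (hφ : ContDiffAt ℝ 3 φ y)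
    (hs : ∀ z, (h z).IsSymm) (hd : (h (φ y)).det ≠ 0) (hJ : (jac φ y).det ≠ 0)
    (hh : ∀ i j, ContDiffAt ℝ 2 (fun z => h z i j) (φ y))
    (hh' : ∀ i j, ContDiffAt ℝ 2 (fun z => h' z i j) y) :
    ricciScalar h' y = ricciScalar h (φ y) := by
  let R : Matrix (Fin 2) (Fin 2) ℝ := Matrix.of fun b d => ricci h b d (φ y)
  let R' : Matrix (Fin 2) (Fin 2) ℝ := Matrix.of fun b d => ricci h' b d y
  have hR : R' = (jac φ y).transpose * R * jac φ y := by
    ext b d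
    simp only [R, R', Matrix.of_apply, H.ricci_eq hφ hs hd hJ hh hh' b d, Matrix.mul_apply,
      Matrix.transpose_apply, Fin.sum_univ_two]
    ring
  change ∑ b, ∑ d, R' b d * (h' y)⁻¹ b d = ∑ b, ∑ d, R b d * (h (φ y))⁻¹ b d
  rw [sum_mul_eq_trace, sum_mul_eq_trace, hR, ← H.mul_inv_mul hJ, Matrix.transpose_mul,
    Matrix.transpose_mul, Matrix.transpose_transpose, Matrix.mul_assoc, Matrix.mul_assoc,
    Matrix.trace_mul_comm, Matrix.mul_assoc, Matrix.mul_assoc]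

/-- `S'` is mapped to `S` by `φ` near `y`, as a contravariant tensor field. -/
def IsPushforward (φ : Coord → Coord) (S' S : Coord → Matrix (Fin 2) (Fin 2) ℝ) (y : Coord) :
    Prop :=
  ∀ᶠ z in 𝓝 y, S (φ z) = jac φ z * S' z * (jac φ z).transpose

variable {S S' : Coord → Matrix (Fin 2) (Fin 2) ℝ}

/-- Cyclicity of the matrix trace moves the Jacobians next to each other. -/
theorem IsPullback.trace_eq (H : IsPullback φ h h' y) (HS : IsPushforward φ S' S y) :
    trace h' S' y = trace h S (φ y) := by
  rw [trace, trace, sum_mul_eq_trace, sum_mul_eq_trace, H.eq, HS.self_of_nhds,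
    Matrix.transpose_mul, Matrix.transpose_mul, Matrix.transpose_transpose, Matrix.mul_assoc,
    Matrix.mul_assoc, Matrix.trace_mul_comm, Matrix.mul_assoc, Matrix.mul_assoc]

/-- The transformation law of the divergence. -/
theorem IsPullback.divergence_eq (H : IsPullback φ h h' y) (HS : IsPushforward φ S' S y)
    (hφ : ContDiffAt ℝ 2 φ y) (hs : ∀ z, (h z).IsSymm) (hd : (h (φ y)).det ≠ 0)
    (hJ : (jac φ y).det ≠ 0) (hh : ∀ i j, DifferentiableAt ℝ (fun z => h z i j) (φ y))
    (hS : ∀ i j, DifferentiableAt ℝ (fun z => S z i j) (φ y))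
    (hS' : ∀ i j, DifferentiableAt ℝ (fun z => S' z i j) y) (i : Fin 2) :
    ∑ a, jac φ y i a * divergence h' S' a y = divergence h S i (φ y) := by
  have hφ1 : DifferentiableAt ℝ φ y := hφ.differentiableAt (by norm_num)
  have hJd : ∀ i a, DifferentiableAt ℝ (fun z => jac φ z i a) y := fun i a =>
    (contDiffAt_jac (m := 1) hφ (by norm_num) i a).differentiableAt (by norm_num)
  have C := H.christoffel_eq hφ hs hd hJ hh
  have hc := partialDeriv_jac_comm hφ
  have V : ∀ i j, S (φ y) i j = ∑ a, ∑ b, jac φ y i a * S' y a b * jac φ y j b := fun i j => by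
    rw [HS.self_of_nhds]
    simp only [Matrix.mul_apply, Matrix.transpose_apply, Fin.sum_univ_two]
    ring
  have D : ∀ i j c, ∑ k, partialDeriv k (fun z => S z i j) (φ y) * jac φ y k c = ∑ a, ∑ b,
      (partialDeriv c (fun z => jac φ z i a) y * S' y a b * jac φ y j b
        + jac φ y i a * partialDeriv c (fun z => S' z a b) y * jac φ y j b
        + jac φ y i a * S' y a b * partialDeriv c (fun z => jac φ z j b) y) := by
    intro i j c
    have hev : (fun z => S (φ z) i j) =ᶠ[𝓝 y]
        fun z => ∑ a, ∑ b, jac φ z i a * S' z a b * jac φ z j b := by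
      filter_upwards [HS] with z hz
      simp only [hz, Matrix.mul_apply, Matrix.transpose_apply, Fin.sum_univ_two]
      ring
    have hterm : ∀ a b, DifferentiableAt ℝ (fun z => jac φ z i a * S' z a b * jac φ z j b) y :=
      fun a b => ((hJd i a).fun_mul (hS' a b)).fun_mul (hJd j b)
    rw [← partialDeriv_comp (f := fun z => S z i j) c (hS i j) hφ1, partialDeriv_congr c hev,
      partialDeriv_sum c fun a => DifferentiableAt.fun_sum fun b _ => hterm a b]
    refine Finset.sum_congr rfl fun a _ => ?_
    rw [partialDeriv_sum c fun b => hterm a b]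
    refine Finset.sum_congr rfl fun b _ => ?_
    rw [partialDeriv_mul c ((hJd i a).fun_mul (hS' a b)) (hJd j b),
      partialDeriv_mul c (hJd i a) (hS' a b)]
    ring
  obtain ⟨K, h1, h2⟩ : ∃ K, K * jac φ y = 1 ∧ jac φ y * K = 1 :=
    ⟨(jac φ y)⁻¹, Matrix.nonsing_inv_mul _ hJ.isUnit, Matrix.mul_nonsing_inv _ hJ.isUnit⟩
  have m : ∀ k j, jac φ y k 0 * K 0 j + jac φ y k 1 * K 1 j
      = (1 : Matrix (Fin 2) (Fin 2) ℝ) k j := fun k j => by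
    rw [← h2, Matrix.mul_apply, Fin.sum_univ_two]
  have n : ∀ b c, K b 0 * jac φ y 0 c + K b 1 * jac φ y 1 c
      = (1 : Matrix (Fin 2) (Fin 2) ℝ) b c := fun b c => by
    rw [← h1, Matrix.mul_apply, Fin.sum_univ_two]
  have m00 := m 0 0
  have m01 := m 0 1
  have m10 := m 1 0
  have m11 := m 1 1
  have n00 := n 0 0
  have n01 := n 0 1
  have n10 := n 1 0
  have n11 := n 1 1
  simp only [Matrix.one_apply_eq, Matrix.one_apply_ne (by decide : (0 : Fin 2) ≠ 1),
    Matrix.one_apply_ne (by decide : (1 : Fin 2) ≠ 0)] at m00 m01 m10 m11 n00 n01 n10 n11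
  -- The contracted Christoffel law. Its inhomogeneous term, the logarithmic derivative of the
  -- Jacobian determinant, is cancelled by the last term of `DD`.
  have G : ∀ c, ∑ b, christoffel h' b b c y =
      (∑ j, ∑ k, christoffel h j j k (φ y) * jac φ y k c)
        + ∑ j, ∑ b, K b j * partialDeriv b (fun z => jac φ z j c) y := by
    intro c
    have C00 := C 0 0 c
    have C01 := C 0 1 c
    have C10 := C 1 0 c
    have C11 := C 1 1 c
    simp only [Fin.sum_univ_two] at C00 C01 C10 C11 ⊢
    let g : Fin 2 → Fin 2 → ℝ := fun i j =>
      christoffel h i j 0 (φ y) * jac φ y 0 c + christoffel h i j 1 (φ y) * jac φ y 1 c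
    linear_combination K 0 0 * C00 + K 0 1 * C10 + K 1 0 * C01 + K 1 1 * C11
      - christoffel h' 0 0 c y * n00 - christoffel h' 1 0 c y * n01
      - christoffel h' 0 1 c y * n10 - christoffel h' 1 1 c y * n11
      + g 0 0 * m00 + g 0 1 * m10 + g 1 0 * m01 + g 1 1 * m11
  have DD : ∑ j, partialDeriv j (fun z => S z i j) (φ y) = ∑ a, ∑ b,
      (partialDeriv b (fun z => jac φ z i a) y * S' y a b
        + jac φ y i a * partialDeriv b (fun z => S' z a b) y
        + jac φ y i a * S' y a b *
          ∑ j, ∑ c, K c j * partialDeriv c (fun z => jac φ z j b) y) := by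
    have D00 := D i 0 0
    have D01 := D i 0 1
    have D10 := D i 1 0
    have D11 := D i 1 1
    simp only [Fin.sum_univ_two] at D00 D01 D10 D11 ⊢
    let s : Fin 2 → Fin 2 → ℝ := fun k j => partialDeriv k (fun z => S z i j) (φ y)
    let w : Fin 2 → Fin 2 → ℝ := fun b c =>
      partialDeriv c (fun z => jac φ z i 0) y * S' y 0 b
        + partialDeriv c (fun z => jac φ z i 1) y * S' y 1 b
        + jac φ y i 0 * partialDeriv c (fun z => S' z 0 b) y
        + jac φ y i 1 * partialDeriv c (fun z => S' z 1 b) y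
    linear_combination K 0 0 * D00 + K 1 0 * D01 + K 0 1 * D10 + K 1 1 * D11
      - s 0 0 * m00 - s 0 1 * m01 - s 1 0 * m10 - s 1 1 * m11
      + w 0 0 * n00 + w 1 0 * n01 + w 0 1 * n10 + w 1 1 * n11
  have G0 := G 0
  have G1 := G 1
  have C00 := C i 0 0
  have C01 := C i 0 1
  have C10 := C i 1 0
  have C11 := C i 1 1
  simp only [divergence, Fin.sum_univ_two, V] at DD G0 G1 C00 C01 C10 C11 ⊢
  linear_combination -DD + S' y 0 0 * C00 + S' y 1 0 * C01 + S' y 0 1 * C10 + S' y 1 1 * C11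
    + (jac φ y i 0 * S' y 0 0 + jac φ y i 1 * S' y 1 0) * G0
    + (jac φ y i 0 * S' y 0 1 + jac φ y i 1 * S' y 1 1) * G1

end Pullback

end Spacetime2

end

noncomputable section

namespace Spacetime2

open Filter

/-! ### Local construction of the stress tensor in one coordinate system -/

section Divergence

variable {h : Coord → Matrix (Fin 2) (Fin 2) ℝ} {y : Coord}

theorem divergence_add {S T : Coord → Matrix (Fin 2) (Fin 2) ℝ}
    (hS : ∀ i j, DifferentiableAt ℝ (fun z => S z i j) y)
    (hT : ∀ i j, DifferentiableAt ℝ (fun z => T z i j) y) (a : Fin 2) :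
    divergence h (fun z => S z + T z) a y = divergence h S a y + divergence h T a y := by
  simp only [divergence, Matrix.add_apply, Fin.sum_univ_two]
  rw [partialDeriv_add 0 (hS a 0) (hT a 0), partialDeriv_add 1 (hS a 1) (hT a 1)]
  ring

/-- The coefficient `c` such that `∇_b (A lᵃ lᵇ) = (l(A) + c A) lᵃ` for a null field `l = (1, v)`. -/
def nullCoeff (h : Coord → Matrix (Fin 2) (Fin 2) ℝ) (v : Coord → ℝ) (y : Coord) : ℝ :=
  partialDeriv 1 v y + ∑ b, ∑ c, christoffel h b b c y * ![1, v y] c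
    + ∑ b, ∑ c, christoffel h 0 b c y * ![1, v y] b * ![1, v y] c

/-- Differentiating h(l, l) = 0 along l gives h(∇_l l, l) = 0. In dimension two the orthogonal
complement of a null l is its own span, so ∇_l l is a multiple of l. The condition `hne` says h(∂₁,
l) ≠ 0, which is what allows the component of ∇_l l transverse to l to be divided out. -/
theorem divergence_null (hs : ∀ z, (h z).IsSymm) (hd : (h y).det ≠ 0)
    (hh : ∀ i j, DifferentiableAt ℝ (fun z => h z i j) y) {v A : Coord → ℝ}
    (hv : DifferentiableAt ℝ v y) (hA : DifferentiableAt ℝ A y)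
    (hnull : ∀ᶠ z in 𝓝 y, h z 0 0 + 2 * (h z 0 1 * v z) + h z 1 1 * (v z * v z) = 0)
    (hne : h y 0 1 + h y 1 1 * v y ≠ 0) (a : Fin 2) :
    divergence h (fun z => A z • Matrix.vecMulVec ![1, v z] ![1, v z]) a y =
      ![1, v y] a * (partialDeriv 0 A y + v y * partialDeriv 1 A y + nullCoeff h v y * A y) := by
  have hnd : ∀ c, partialDeriv c (fun z => h z 0 0) y
      + 2 * (partialDeriv c (fun z => h z 0 1) y * v y + h y 0 1 * partialDeriv c v y)
      + (partialDeriv c (fun z => h z 1 1) y * (v y * v y)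
        + h y 1 1 * (partialDeriv c v y * v y + v y * partialDeriv c v y)) = 0 := by
    intro c
    have h1 := partialDeriv_congr (g := fun _ => 0) c hnull
    have h2 : DifferentiableAt ℝ (fun _ : Coord => (2 : ℝ)) y := differentiableAt_const 2
    have e1 := (hh 0 1).fun_mul hv
    have e2 := hv.fun_mul hv
    rw [partialDeriv_add c ((hh 0 0).fun_add (h2.fun_mul e1)) ((hh 1 1).fun_mul e2),
      partialDeriv_add c (hh 0 0) (h2.fun_mul e1), partialDeriv_mul c h2 e1,
      partialDeriv_mul c (hh 0 1) hv, partialDeriv_mul c (hh 1 1) e2, partialDeriv_mul c hv hv] at h1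
    simpa using h1
  have hn := hnull.self_of_nhds
  have hm := partialDeriv_metric hs hd
  have h10 : h y 1 0 = h y 0 1 := (hs y).apply 0 1
  have hΓ : ∀ a, christoffel h a 1 0 y = christoffel h a 0 1 y := fun a =>
    christoffel_symm hs a 1 0 y
  let Q : Fin 2 → ℝ := fun a => christoffel h a 0 0 y + 2 * christoffel h a 0 1 y * v y
    + christoffel h a 1 1 y * v y * v y
  -- The integral curves of a null vector field are pregeodesics.
  have geod : partialDeriv 0 v y + v y * partialDeriv 1 v y + Q 1 = v y * Q 0 := by
    have h0 := hnd 0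
    have h1 := hnd 1
    rw [hm, hm, hm] at h0 h1
    simp only [Fin.sum_univ_two, h10, hΓ] at h0 h1
    refine mul_left_cancel₀ hne ?_
    simp only [Q]
    linear_combination (1 / 2) * h0 + (1 / 2) * v y * h1
      - (christoffel h 0 0 0 y + 2 * christoffel h 0 0 1 y * v y
        + christoffel h 0 1 1 y * v y * v y) * hn
  have hA1 : ∀ c, partialDeriv c (fun z => A z * v z) y =
      partialDeriv c A y * v y + A y * partialDeriv c v y := fun c => partialDeriv_mul c hA hv
  have hA2 : ∀ c, partialDeriv c (fun z => A z * (v z * v z)) y =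
      partialDeriv c A y * (v y * v y)
        + A y * (partialDeriv c v y * v y + v y * partialDeriv c v y) := fun c => by
    rw [partialDeriv_mul c hA (hv.fun_mul hv), partialDeriv_mul c hv hv]
  fin_cases a
  · simp [divergence, nullCoeff, Fin.sum_univ_two, hΓ, hA1]
    ring
  · simp [divergence, nullCoeff, Fin.sum_univ_two, hΓ, hA1, hA2]
    simp only [Q] at geod
    linear_combination A y * geod

/-- The inverse metric is parallel too: differentiate h⁻¹ h = 1 and insert `partialDeriv_metric`. -/
theorem partialDeriv_inv (hs : ∀ z, (h z).IsSymm) (hd : (h y).det ≠ 0)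
    (hh : ∀ i j, ContDiffAt ℝ 1 (fun z => h z i j) y) (c a b : Fin 2) :
    partialDeriv c (fun z => (h z)⁻¹ a b) y = -(∑ d, christoffel h a c d y * (h y)⁻¹ d b
      + ∑ d, christoffel h b c d y * (h y)⁻¹ a d) := by
  have hi : ∀ i j, DifferentiableAt ℝ (fun z => (h z)⁻¹ i j) y := fun i j =>
    (contDiffAt_inv hh hd i j).differentiableAt (by norm_num)
  have hhd : ∀ i j, DifferentiableAt ℝ (fun z => h z i j) y := fun i j =>
    (hh i j).differentiableAt (by norm_num)
  let dH : Matrix (Fin 2) (Fin 2) ℝ := Matrix.of fun a b => partialDeriv c (fun z => (h z)⁻¹ a b) y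
  let dh : Matrix (Fin 2) (Fin 2) ℝ := Matrix.of fun a b => partialDeriv c (fun z => h z a b) y
  let Γ : Matrix (Fin 2) (Fin 2) ℝ := Matrix.of fun a d => christoffel h a c d y
  have h1 : h y * (h y)⁻¹ = 1 := Matrix.mul_nonsing_inv _ hd.isUnit
  have h2 : (h y)⁻¹ * h y = 1 := Matrix.nonsing_inv_mul _ hd.isUnit
  have e1 : dh = h y * Γ + Γ.transpose * h y := by
    ext i j
    simp only [dh, Γ, Matrix.of_apply, partialDeriv_metric hs hd, Matrix.add_apply,
      Matrix.mul_apply, Matrix.transpose_apply, (hs y).apply _ j]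
    congr 1
    refine Finset.sum_congr rfl fun d _ => ?_
    rw [mul_comm]
  have e2 : dH * h y + (h y)⁻¹ * dh = 0 := by
    ext i j
    have hev : (fun z => ∑ k, (h z)⁻¹ i k * h z k j) =ᶠ[𝓝 y]
        fun _ => (1 : Matrix (Fin 2) (Fin 2) ℝ) i j := by
      filter_upwards [(contDiffAt_det hh).continuousAt.eventually_ne hd] with z hz
      rw [← Matrix.nonsing_inv_mul (h z) hz.isUnit, Matrix.mul_apply]
    have h3 := partialDeriv_congr c hev
    rw [partialDeriv_sum c fun k => (hi i k).fun_mul (hhd k j), partialDeriv_const,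
      Finset.sum_congr rfl fun k _ => partialDeriv_mul c (hi i k) (hhd k j),
      Finset.sum_add_distrib] at h3
    exact h3
  have e3 : dH = -(Γ * (h y)⁻¹ + (h y)⁻¹ * Γ.transpose) := by
    have h4 := congrArg (· * (h y)⁻¹) e2
    simp only [e1, Matrix.add_mul, Matrix.mul_add, Matrix.zero_mul] at h4
    rw [Matrix.mul_assoc dH, h1, Matrix.mul_one, ← Matrix.mul_assoc, h2, Matrix.one_mul,
      Matrix.mul_assoc (h y)⁻¹ _ (h y)⁻¹, Matrix.mul_assoc Γ.transpose, h1, Matrix.mul_one] at h4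
    exact eq_neg_of_add_eq_zero_left h4
  have h5 := congrFun (congrFun e3 a) b
  simp only [dH, Γ, Matrix.of_apply, Matrix.neg_apply, Matrix.add_apply, Matrix.mul_apply,
    Matrix.transpose_apply] at h5
  rw [h5]
  congr 2
  exact Finset.sum_congr rfl fun d _ => mul_comm _ _

theorem divergence_smul_inv (hs : ∀ z, (h z).IsSymm) (hd : (h y).det ≠ 0)
    (hh : ∀ i j, ContDiffAt ℝ 1 (fun z => h z i j) y) {F : Coord → ℝ}
    (hF : DifferentiableAt ℝ F y) (a : Fin 2) :
    divergence h (fun z => F z • (h z)⁻¹) a y = ∑ b, (h y)⁻¹ a b * partialDeriv b F y := by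
  have hi : ∀ i j, DifferentiableAt ℝ (fun z => (h z)⁻¹ i j) y := fun i j =>
    (contDiffAt_inv hh hd i j).differentiableAt (by norm_num)
  simp only [divergence, Matrix.smul_apply, smul_eq_mul]
  rw [Finset.sum_congr rfl fun b _ => by rw [partialDeriv_mul b hF (hi a b),
    partialDeriv_inv hs hd hh]]
  simp only [Fin.sum_univ_two]
  ring

end Divergence

/-! ### The null-frame ansatz -/

section LocalExistence

/-- The condition h₁₁ ≠ 0 makes ∂₁ non-null, so both null directions can be normalized to have first
component 1, the form required by the transport equations. -/
theorem exists_local_tensor_of_ne_zero {h : Coord → Matrix (Fin 2) (Fin 2) ℝ} {F : Coord → ℝ}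
    {p : Coord} (hs : ∀ z, (h z).IsSymm) (hh : ∀ i j, ContDiffAt ℝ 2 (fun z => h z i j) p)
    (hF : ContDiffAt ℝ 2 F p) (hd : (h p).det < 0) (h11 : h p 1 1 ≠ 0) :
    ∃ S : Coord → Matrix (Fin 2) (Fin 2) ℝ, (∀ z, (S z).IsSymm) ∧
      (∀ i j, ContDiffAt ℝ 1 (fun z => S z i j) p) ∧
      ∀ᶠ y in 𝓝 p, trace h S y = F y ∧ ∀ a, divergence h S a y = 0 := by
  let q : Coord → ℝ := fun z => Real.sqrt (-(h z).det)
  -- v and w are the two roots of h₀₀ + 2 h₀₁ u + h₁₁ u² = 0, real and distinct since det h < 0. The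
  -- factor k normalizes h⁻¹ = k (l ⊗ n + n ⊗ l), and F₂ is half of F because h⁻¹ has trace 2.
  let v : Coord → ℝ := fun z => (-h z 0 1 + q z) / h z 1 1
  let w : Coord → ℝ := fun z => (-h z 0 1 - q z) / h z 1 1
  let k : Coord → ℝ := fun z => h z 1 1 / (2 * (h z).det)
  let F₂ : Coord → ℝ := fun z => 1 / 2 * F z
  have hdet := contDiffAt_det hh
  have hq : ContDiffAt ℝ 2 q p := hdet.neg.sqrt (neg_ne_zero.2 hd.ne)
  have hv : ContDiffAt ℝ 2 v p := ((hh 0 1).neg.add hq).div (hh 1 1) h11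
  have hw : ContDiffAt ℝ 2 w p := ((hh 0 1).neg.sub hq).div (hh 1 1) h11
  have hk : ContDiffAt ℝ 2 k p :=
    (hh 1 1).div (contDiffAt_const.mul hdet) (mul_ne_zero two_ne_zero hd.ne)
  have hF₂ : ContDiffAt ℝ 2 F₂ p := contDiffAt_const.mul hF
  have h12 : (1 : WithTop ℕ∞) ≤ 2 := by norm_num
  have hc : ∀ u : Coord → ℝ, ContDiffAt ℝ 2 u p → ContDiffAt ℝ 1 (nullCoeff h u) p := by
    intro u hu
    have hu' : ∀ c, ContDiffAt ℝ 1 (fun z => ![1, u z] c) p := by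
      intro c
      fin_cases c
      · exact contDiffAt_const
      · exact hu.of_le h12
    have hΓ := contDiffAt_christoffel (m := 1) hh hd.ne (by norm_num)
    exact ((contDiffAt_partialDeriv 1 hu (by norm_num)).add
      (ContDiffAt.sum fun b _ => ContDiffAt.sum fun c _ => (hΓ b b c).mul (hu' c))).add
      (ContDiffAt.sum fun b _ => ContDiffAt.sum fun c _ =>
        ((hΓ 0 b c).mul (hu' b)).mul (hu' c))
  have hsrc : ∀ u : Coord → ℝ, ContDiffAt ℝ 2 u p → ContDiffAt ℝ 1
      (fun z => -k z * (partialDeriv 0 F₂ z + u z * partialDeriv 1 F₂ z)) p := fun u hu =>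
    (hk.of_le h12).neg.mul ((contDiffAt_partialDeriv 0 hF₂ (by norm_num)).add
      ((hu.of_le h12).mul (contDiffAt_partialDeriv 1 hF₂ (by norm_num))))
  -- The sources are crossed: the l-component of the gradient of F₂ is k n(F₂), and the n-component
  -- is k l(F₂).
  obtain ⟨A, hA, hAe⟩ := exists_transport_solution (hv.of_le h12) (hc v hv) (hsrc w hw)
  obtain ⟨B, hB, hBe⟩ := exists_transport_solution (hw.of_le h12) (hc w hw) (hsrc v hv)
  have hnullC : ∀ u D : Coord → ℝ, ∀ y, ContDiffAt ℝ 1 u y → ContDiffAt ℝ 1 D y →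
      ∀ i j, ContDiffAt ℝ 1 (fun z => (D z • Matrix.vecMulVec ![1, u z] ![1, u z]) i j) y := by
    intro u D y hu hD
    have hu' : ∀ c, ContDiffAt ℝ 1 (fun z => ![1, u z] c) y := by
      intro c
      fin_cases c
      · exact contDiffAt_const
      · exact hu
    intro i j
    exact hD.mul ((hu' i).mul (hu' j))
  have hinvC : ∀ y, (h y).det ≠ 0 → ContDiffAt ℝ 1 F₂ y →
      (∀ i j, ContDiffAt ℝ 1 (fun z => h z i j) y) →
      ∀ i j, ContDiffAt ℝ 1 (fun z => (F₂ z • (h z)⁻¹) i j) y := fun y h1 h2 h3 i j =>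
    h2.mul (contDiffAt_inv h3 h1 i j)
  refine ⟨fun z => A z • Matrix.vecMulVec ![1, v z] ![1, v z]
    + B z • Matrix.vecMulVec ![1, w z] ![1, w z] + F₂ z • (h z)⁻¹, fun z => ?_, fun i j => ?_, ?_⟩
  · refine Matrix.IsSymm.add (Matrix.IsSymm.add ?_ ?_) ?_
    · exact Matrix.IsSymm.smul (Matrix.transpose_vecMulVec _ _) _
    · exact Matrix.IsSymm.smul (Matrix.transpose_vecMulVec _ _) _
    · exact Matrix.IsSymm.smul (by rw [Matrix.IsSymm, Matrix.transpose_nonsing_inv, hs z]) _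
  · exact ((hnullC v A p (hv.of_le h12) hA i j).add (hnullC w B p (hw.of_le h12) hB i j)).add
      (hinvC p hd.ne (hF₂.of_le h12) (fun i j => (hh i j).of_le h12) i j)
  have ev1 : ∀ᶠ y in 𝓝 p, ∀ i j, ContDiffAt ℝ 2 (fun z => h z i j) y :=
    eventually_all.2 fun i => eventually_all.2 fun j => (hh i j).eventually (by simp)
  have ev2 : ∀ᶠ y in 𝓝 p, (h y).det < 0 := hdet.continuousAt.eventually_lt continuousAt_const hd
  have ev3 : ∀ᶠ y in 𝓝 p, h y 1 1 ≠ 0 := (hh 1 1).continuousAt.eventually_ne h11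
  have alg : ∀ᶠ y in 𝓝 p, (h y 0 0 + 2 * (h y 0 1 * v y) + h y 1 1 * (v y * v y) = 0 ∧
      h y 0 0 + 2 * (h y 0 1 * w y) + h y 1 1 * (w y * w y) = 0) ∧
      (h y 0 1 + h y 1 1 * v y ≠ 0 ∧ h y 0 1 + h y 1 1 * w y ≠ 0) ∧
      ∀ a b, (h y)⁻¹ a b = k y * (![1, v y] a * ![1, w y] b + ![1, w y] a * ![1, v y] b) := by
    filter_upwards [ev2, ev3] with y y2 y3
    have hq2 : q y * q y = -(h y).det := Real.mul_self_sqrt (by linarith)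
    have hq0 : q y ≠ 0 := (Real.sqrt_pos.2 (by linarith)).ne'
    have h10 : h y 1 0 = h y 0 1 := (hs y).apply 0 1
    have hdd : (h y).det = h y 0 0 * h y 1 1 - h y 0 1 * h y 0 1 := by
      rw [Matrix.det_fin_two, h10]
    have hvy : h y 1 1 * v y = -h y 0 1 + q y := by simp only [v]; field_simp
    have hwy : h y 1 1 * w y = -h y 0 1 - q y := by simp only [w]; field_simp
    refine ⟨⟨?_, ?_⟩, ⟨?_, ?_⟩, ?_⟩
    · refine mul_left_cancel₀ y3 ?_
      linear_combination (h y 0 1 + q y + h y 1 1 * v y) * hvy + hq2 - hdd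
    · refine mul_left_cancel₀ y3 ?_
      linear_combination (h y 0 1 - q y + h y 1 1 * w y) * hwy + hq2 - hdd
    · rw [hvy]; simpa using hq0
    · rw [hwy]
      intro h0
      exact hq0 (by linarith)
    -- Vieta's formulas for the two null slopes give the entries of the inverse metric.
    · have hsum : h y 1 1 * (v y + w y) = -2 * h y 0 1 := by linear_combination hvy + hwy
      have hprod : h y 1 1 * (v y * w y) = h y 0 0 := by
        refine mul_left_cancel₀ y3 ?_
        linear_combination h y 1 1 * w y * hvy + (-h y 0 1 + q y) * hwy - hq2 + hdd
      have hdn : (h y).det ≠ 0 := y2.ne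
      intro a b
      rw [inv_apply_fin_two]
      simp only [k, h10]
      fin_cases a <;> fin_cases b <;> simp <;> field_simp
      · norm_num
      · linear_combination -hsum
      · linear_combination -hsum
      · linear_combination -2 * hprod
  filter_upwards [ev1, ev2, alg.eventually_nhds, hAe, hBe, hF₂.eventually (by simp),
    hv.eventually (by simp), hw.eventually (by simp), hA.eventually (by simp),
    hB.eventually (by simp)] with y y1 y2 yalg yA yB yF yv yw yAd yBd
  obtain ⟨⟨nv, nw⟩, ⟨nev, new⟩, hinv⟩ := yalg.self_of_nhds
  have y1' : ∀ i j, ContDiffAt ℝ 1 (fun z => h z i j) y := fun i j => (y1 i j).of_le h12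
  have y1d : ∀ i j, DifferentiableAt ℝ (fun z => h z i j) y := fun i j =>
    (y1' i j).differentiableAt one_ne_zero
  have dA := fun i j => (hnullC v A y (yv.of_le h12) yAd i j).differentiableAt one_ne_zero
  have dB := fun i j => (hnullC w B y (yw.of_le h12) yBd i j).differentiableAt one_ne_zero
  have dI := fun i j => (hinvC y y2.ne (yF.of_le h12) y1' i j).differentiableAt one_ne_zero
  constructor
  · have h10 : h y 1 0 = h y 0 1 := (hs y).apply 0 1
    have htr : ∑ a, ∑ b, h y a b * (h y)⁻¹ a b = 2 := by
      rw [sum_mul_eq_trace, Matrix.transpose_nonsing_inv, hs y,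
        Matrix.mul_nonsing_inv _ y2.ne.isUnit]
      simp
    simp only [Fin.sum_univ_two, h10] at htr
    simp [trace, Fin.sum_univ_two, h10, F₂]
    linear_combination A y * nv + B y * nw + 1 / 2 * F y * htr
  · intro a
    rw [divergence_add (S := fun z => A z • Matrix.vecMulVec ![1, v z] ![1, v z]
      + B z • Matrix.vecMulVec ![1, w z] ![1, w z]) (T := fun z => F₂ z • (h z)⁻¹) (fun i j => (dA i j).fun_add (dB i j)) dI, divergence_add dA dB,
      divergence_null hs y2.ne y1d (yv.differentiableAt (by norm_num))
        (yAd.differentiableAt one_ne_zero) (yalg.mono fun z hz => hz.1.1) nev,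
      divergence_null hs y2.ne y1d (yw.differentiableAt (by norm_num))
        (yBd.differentiableAt one_ne_zero) (yalg.mono fun z hz => hz.1.2) new,
      divergence_smul_inv hs y2.ne y1' (yF.differentiableAt (by norm_num)), yA, yB]
    simp only [hinv, Fin.sum_univ_two, Matrix.cons_val_zero, Matrix.cons_val_one]
    ring

end LocalExistence

end Spacetime2

end

noncomputable section

namespace Spacetime2

open Filter

/-! ### Reduction to a metric that is diagonal at the point -/

section LinearChange

/-- The linear map of the coordinate space with matrix `Q`. -/
def linearChange (Q : Matrix (Fin 2) (Fin 2) ℝ) (z : Coord) : Coord :=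
  WithLp.toLp 2 (Q.mulVec z.ofLp)

theorem linearChange_linearChange (Q K : Matrix (Fin 2) (Fin 2) ℝ) (z : Coord) :
    linearChange Q (linearChange K z) = linearChange (Q * K) z := by
  simp only [linearChange, Matrix.mulVec_mulVec]

theorem linearChange_one (z : Coord) : linearChange 1 z = z := by
  simp [linearChange]

theorem linearChange_apply (Q : Matrix (Fin 2) (Fin 2) ℝ) (z : Coord) (i : Fin 2) :
    linearChange Q z i = ∑ b, Q i b * z b := rfl

theorem contDiff_linearChange (Q : Matrix (Fin 2) (Fin 2) ℝ) {n : WithTop ℕ∞} :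
    ContDiff ℝ n (linearChange Q) := by
  rw [contDiff_euclidean]
  intro i
  simp only [linearChange_apply]
  fun_prop

theorem jac_linearChange (Q : Matrix (Fin 2) (Fin 2) ℝ) (z : Coord) :
    jac (linearChange Q) z = Q := by
  ext i a
  have hp : ∀ b : Fin 2, HasFDerivAt (fun z : Coord => Q i b * z b)
      (Q i b • (EuclideanSpace.proj b : Coord →L[ℝ] ℝ)) z := fun b =>
    (EuclideanSpace.proj b : Coord →L[ℝ] ℝ).hasFDerivAt.const_mul (Q i b)
  have h2 : HasFDerivAt (fun z : Coord => Q i 0 * z 0 + Q i 1 * z 1) _ z := (hp 0).add (hp 1)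
  simp only [jac, Matrix.of_apply, linearChange_apply, Fin.sum_univ_two, partialDeriv]
  rw [h2.fderiv]
  fin_cases a <;> simp

/-- On a coordinate domain, every function of class `C²` is locally the trace of a symmetric tensor
field of class `C¹` without divergence. -/
theorem exists_local_tensor {h : Coord → Matrix (Fin 2) (Fin 2) ℝ} {F : Coord → ℝ}
    {p : Coord} (hs : ∀ z, (h z).IsSymm) (hh : ∀ i j, ContDiffAt ℝ 2 (fun z => h z i j) p)
    (hF : ContDiffAt ℝ 2 F p) {Q : Matrix (Fin 2) (Fin 2) ℝ}
    (hQ : Q.transpose * h p * Q = !![-1, 0; 0, 1]) :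
    ∃ S : Coord → Matrix (Fin 2) (Fin 2) ℝ, (∀ z, (S z).IsSymm) ∧
      (∀ i j, ContDiffAt ℝ 1 (fun z => S z i j) p) ∧
      ∀ᶠ y in 𝓝 p, trace h S y = F y ∧ ∀ a, divergence h S a y = 0 := by
  have hdet : Q.det * (h p).det * Q.det = -1 := by
    rw [← Matrix.det_transpose Q, ← Matrix.det_mul, Matrix.det_transpose, ← Matrix.det_mul, hQ]
    simp
  have hQ0 : Q.det ≠ 0 := by
    intro h0
    rw [h0] at hdet
    norm_num at hdet
  have hp0 : (h p).det ≠ 0 := by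
    intro h0
    rw [h0] at hdet
    norm_num at hdet
  have hQK : Q * Q⁻¹ = 1 := Matrix.mul_nonsing_inv _ hQ0.isUnit
  have hKQ : Q⁻¹ * Q = 1 := Matrix.nonsing_inv_mul _ hQ0.isUnit
  let φ := linearChange Q
  let ψ := linearChange Q⁻¹
  have hφψ : ∀ y, φ (ψ y) = y := fun y => by
    simp only [φ, ψ, linearChange_linearChange, hQK, linearChange_one]
  have hψφ : ∀ y, ψ (φ y) = y := fun y => by
    simp only [φ, ψ, linearChange_linearChange, hKQ, linearChange_one]
  let h' : Coord → Matrix (Fin 2) (Fin 2) ℝ := fun z => Q.transpose * h (φ z) * Q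
  have hpb : ∀ z, IsPullback φ h h' z := fun z => Eventually.of_forall fun w => by
    rw [jac_linearChange]
  have hs' : ∀ z, (h' z).IsSymm := fun z => by
    rw [Matrix.IsSymm, Matrix.transpose_mul, Matrix.transpose_mul, Matrix.transpose_transpose,
      hs (φ z)]
    exact (Matrix.mul_assoc _ _ _).symm
  have hcomp : ∀ {n : WithTop ℕ∞} {f : Coord → ℝ}, ContDiffAt ℝ n f p →
      ContDiffAt ℝ n (fun z => f (φ z)) (ψ p) := by
    intro n f hf
    rw [← hφψ p] at hf
    exact hf.comp (ψ p) (contDiff_linearChange Q).contDiffAt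
  have hh' : ∀ i j, ContDiffAt ℝ 2 (fun z => h' z i j) (ψ p) := by
    intro i j
    simp only [h', Matrix.mul_apply]
    exact ContDiffAt.sum fun k _ => (ContDiffAt.sum fun l _ =>
      contDiffAt_const.mul (hcomp (hh l k))).mul contDiffAt_const
  have hp' : h' (ψ p) = !![-1, 0; 0, 1] := by
    simp only [h', hφψ, hQ]
  -- In the new linear coordinates the metric at the point is diag(-1, 1), so its determinant is
  -- negative and its (1, 1) entry is nonzero.
  obtain ⟨S', hS's, hS'c, hS'e⟩ := exists_local_tensor_of_ne_zero hs' hh' (hcomp hF)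
    (by rw [hp']; simp) (by rw [hp']; simp)
  have hψc : ContinuousAt ψ p := (contDiff_linearChange (n := 0) Q⁻¹).continuous.continuousAt
  let S : Coord → Matrix (Fin 2) (Fin 2) ℝ := fun y => Q * S' (ψ y) * Q.transpose
  have hSc : ∀ y, (∀ i j, ContDiffAt ℝ 1 (fun z => S' z i j) (ψ y)) →
      ∀ i j, ContDiffAt ℝ 1 (fun z => S z i j) y := by
    intro y hy i j
    simp only [S, Matrix.mul_apply]
    exact ContDiffAt.sum fun k _ => (ContDiffAt.sum fun l _ =>
      contDiffAt_const.mul ((hy l k).comp y (contDiff_linearChange Q⁻¹).contDiffAt)).mul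
        contDiffAt_const
  refine ⟨S, fun z => ?_, hSc p hS'c, ?_⟩
  · rw [Matrix.IsSymm, Matrix.transpose_mul, Matrix.transpose_mul, Matrix.transpose_transpose,
      hS's (ψ z)]
    exact (Matrix.mul_assoc _ _ _).symm
  · have ev : ∀ᶠ z in 𝓝 (ψ p), ∀ i j, ContDiffAt ℝ 1 (fun z => S' z i j) z :=
      eventually_all.2 fun i => eventually_all.2 fun j => (hS'c i j).eventually (by simp)
    filter_upwards [hψc.eventually hS'e, hψc.eventually ev,
      eventually_all.2 fun i => eventually_all.2 fun j => (hh i j).eventually (by simp),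
      (contDiffAt_det hh).continuousAt.eventually_ne hp0] with y y1 y2 y3 y4
    have hpf : IsPushforward φ S' S (ψ y) := Eventually.of_forall fun w => by
      simp only [S, hψφ, φ, jac_linearChange]
    have htr := (hpb (ψ y)).trace_eq hpf
    rw [hφψ] at htr
    refine ⟨?_, fun a => ?_⟩
    · rw [← htr, y1.1, hφψ]
    · have hdiv := (hpb (ψ y)).divergence_eq hpf (contDiff_linearChange Q).contDiffAt hs
        (by rwa [hφψ]) (by rwa [jac_linearChange])
        (fun i j => by rw [hφψ]; exact (y3 i j).differentiableAt (by norm_num))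
        (fun i j => by rw [hφψ]; exact (hSc y y2 i j).differentiableAt one_ne_zero)
        (fun i j => (y2 i j).differentiableAt one_ne_zero) a
      rw [hφψ] at hdiv
      rw [← hdiv]
      simp [y1.2]

end LinearChange

end Spacetime2

end

noncomputable section

namespace Spacetime2

open Filter

theorem natCast_le_infty (n : ℕ) : (n : WithTop ℕ∞) ≤ ∞ := by
  exact_mod_cast (le_top : ((n : ℕ∞)) ≤ ⊤)

/-! ### Tensor components in charts and their transition maps -/

section Charts

theorem eventually_mem_target_and_symm_mem_source {M : Type*} [TopologicalSpace M]
    {e e₀ : OpenPartialHomeomorph M Coord} {y : Coord} (hy : y ∈ e.target) (hy₀ : e.symm y ∈ e₀.source) :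
    ∀ᶠ z in 𝓝 y, z ∈ e.target ∧ e.symm z ∈ e₀.source :=
  (e.open_target.eventually_mem hy).and
    ((e.continuousAt_symm hy).eventually (e₀.open_source.eventually_mem hy₀))

variable {M : Type*} [TopologicalSpace M] [ChartedSpace Coord M]

/-- The coordinate change from the chart `e` to the chart `e₀`. -/
def transition (e e₀ : OpenPartialHomeomorph M Coord) (y : Coord) : Coord := e₀ (e.symm y)

/-- The derivative of the inverse of a chart, as a linear map of the model space. -/
def symmDeriv (e : OpenPartialHomeomorph M Coord) (y : Coord) : Coord →L[ℝ] Coord :=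
  mfderiv (𝓡 2) (𝓡 2) e.symm y

/-- The differential of a coordinate function, as a linear form on the model space. -/
def coordDeriv (e : OpenPartialHomeomorph M Coord) (a : Fin 2) (x : M) : Coord →L[ℝ] ℝ :=
  mfderiv (𝓡 2) 𝓘(ℝ, ℝ) (fun z : M => e z a) x

variable {e e₀ : OpenPartialHomeomorph M Coord}

theorem contDiffAt_transition (he : e ∈ IsManifold.maximalAtlas (𝓡 2) ∞ M)
    (he₀ : e₀ ∈ IsManifold.maximalAtlas (𝓡 2) ∞ M) {y : Coord} (hy : y ∈ e.target)
    (hy₀ : e.symm y ∈ e₀.source) : ContDiffAt ℝ ∞ (transition e e₀) y :=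
  ((contMDiffAt_of_mem_maximalAtlas he₀ hy₀).comp y
    (contMDiffAt_symm_of_mem_maximalAtlas he hy)).contDiffAt

theorem symmDeriv_eq (he : e ∈ IsManifold.maximalAtlas (𝓡 2) ∞ M)
    (he₀ : e₀ ∈ IsManifold.maximalAtlas (𝓡 2) ∞ M) {y : Coord} (hy : y ∈ e.target)
    (hy₀ : e.symm y ∈ e₀.source) :
    symmDeriv e y = (symmDeriv e₀ (transition e e₀ y)).comp (fderiv ℝ (transition e e₀) y) := by
  have h1 : e.symm =ᶠ[𝓝 y] e₀.symm ∘ transition e e₀ := by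
    filter_upwards [eventually_mem_target_and_symm_mem_source hy hy₀] with z hz
    exact (e₀.left_inv hz.2).symm
  have h2 : MDifferentiableAt (𝓡 2) (𝓡 2) e₀.symm (transition e e₀ y) :=
    (contMDiffAt_symm_of_mem_maximalAtlas he₀ (e₀.map_source hy₀)).mdifferentiableAt (by simp)
  have h3 : MDifferentiableAt (𝓡 2) (𝓡 2) (transition e e₀) y :=
    ((contDiffAt_transition he he₀ hy hy₀).differentiableAt (by simp)).mdifferentiableAt
  have h4 : mfderiv (𝓡 2) (𝓡 2) (transition e e₀) y = fderiv ℝ (transition e e₀) y :=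
    mfderiv_eq_fderiv
  have h5 := mfderiv_comp y h2 h3
  rw [h4] at h5
  exact (h1.mfderiv_eq (I := 𝓡 2) (I' := 𝓡 2)).trans h5

theorem coordDeriv_comp_symmDeriv (he : e ∈ IsManifold.maximalAtlas (𝓡 2) ∞ M)
    (he₀ : e₀ ∈ IsManifold.maximalAtlas (𝓡 2) ∞ M) {y : Coord} (hy : y ∈ e.target)
    (hy₀ : e.symm y ∈ e₀.source) (a : Fin 2) :
    (coordDeriv e₀ a (e.symm y)).comp (symmDeriv e y) =
      fderiv ℝ (fun z => transition e e₀ z a) y := by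
  have h0 : ContMDiffAt (𝓡 2) 𝓘(ℝ, ℝ) ∞ (fun z : Coord => z a) (e₀ (e.symm y)) :=
    (EuclideanSpace.proj a : Coord →L[ℝ] ℝ).contDiff.contMDiff.contMDiffAt
  have h1 : MDifferentiableAt (𝓡 2) 𝓘(ℝ, ℝ) (fun z : M => e₀ z a) (e.symm y) :=
    (h0.comp (e.symm y) (contMDiffAt_of_mem_maximalAtlas he₀ hy₀)).mdifferentiableAt (by simp)
  have h2 : MDifferentiableAt (𝓡 2) (𝓡 2) e.symm y :=
    (contMDiffAt_symm_of_mem_maximalAtlas he hy).mdifferentiableAt (by simp)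
  have h3 : mfderiv (𝓡 2) 𝓘(ℝ, ℝ) (fun z => transition e e₀ z a) y =
    fderiv ℝ (fun z => transition e e₀ z a) y := mfderiv_eq_fderiv
  exact (mfderiv_comp y h1 h2).symm.trans h3

theorem fderiv_single_eq {φ : Coord → Coord} {y : Coord} (hφ : DifferentiableAt ℝ φ y)
    (a : Fin 2) : fderiv ℝ φ y (EuclideanSpace.single a 1) =
      ∑ i, jac φ y i a • (EuclideanSpace.single i 1 : Coord) := by
  have hk : ∀ k, HasFDerivAt (fun z => φ z k) ((EuclideanSpace.proj k : Coord →L[ℝ] ℝ).comp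
    (fderiv ℝ φ y)) y := fun k =>
      (EuclideanSpace.proj k : Coord →L[ℝ] ℝ).hasFDerivAt.comp y hφ.hasFDerivAt
  have hj : ∀ k, jac φ y k a = fderiv ℝ φ y (EuclideanSpace.single a 1) k := fun k => by
    rw [jac, Matrix.of_apply, partialDeriv, (hk k).fderiv]
    rfl
  ext k
  simp only [hj]
  fin_cases k <;> simp [Fin.sum_univ_two]

/-- Chain rule for two mutually inverse transition maps; this is the source of the invertibility of
the Jacobian. -/
theorem jac_transition_mul (he : e ∈ IsManifold.maximalAtlas (𝓡 2) ∞ M)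
    (he₀ : e₀ ∈ IsManifold.maximalAtlas (𝓡 2) ∞ M) {y : Coord} (hy : y ∈ e.target)
    (hy₀ : e.symm y ∈ e₀.source) :
    jac (transition e₀ e) (transition e e₀ y) * jac (transition e e₀) y = 1 := by
  have hφ := (contDiffAt_transition he he₀ hy hy₀).differentiableAt (by simp)
  have hx : e₀.symm (transition e e₀ y) = e.symm y := e₀.left_inv hy₀
  have hψ := contDiffAt_transition he₀ he (e₀.map_source hy₀)
    (by rw [e₀.left_inv hy₀]; exact e.map_target hy)
  ext a c
  have h1 := partialDeriv_comp (f := fun z => transition e₀ e z a) c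
    ((contDiffAt_apply hψ a).differentiableAt (by simp)) hφ
  rw [Matrix.mul_apply]
  refine h1.symm.trans ?_
  have h2 : (fun z => transition e₀ e (transition e e₀ z) a) =ᶠ[𝓝 y] fun z => z a := by
    filter_upwards [eventually_mem_target_and_symm_mem_source hy hy₀] with z hz
    rw [transition, transition, e₀.left_inv hz.2, e.right_inv hz.1]
  rw [partialDeriv_congr c h2, partialDeriv]
  have h3 : HasFDerivAt (fun z : Coord => z a) (EuclideanSpace.proj a : Coord →L[ℝ] ℝ) y :=
    (EuclideanSpace.proj a : Coord →L[ℝ] ℝ).hasFDerivAt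
  rw [h3.fderiv]
  simp [Matrix.one_apply]

/-- The components of a covariant tensor field transform by pullback. -/
theorem isPullback_components (g : CovTensorField M)
    (he : e ∈ IsManifold.maximalAtlas (𝓡 2) ∞ M)
    (he₀ : e₀ ∈ IsManifold.maximalAtlas (𝓡 2) ∞ M) {y : Coord} (hy : y ∈ e.target)
    (hy₀ : e.symm y ∈ e₀.source) :
    IsPullback (transition e e₀) (g.components e₀) (g.components e) y := by
  -- Viewing every tangent space as the model space removes the dependence of the type on the base
  -- point, so that `hx` can be used for rewriting.
  let B : M → LinearMap.BilinForm ℝ Coord := g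
  have hB : ∀ (e : OpenPartialHomeomorph M Coord) z a b, g.components e z a b =
    B (e.symm z) (symmDeriv e z (EuclideanSpace.single a 1))
      (symmDeriv e z (EuclideanSpace.single b 1)) := fun _ _ _ _ => rfl
  filter_upwards [eventually_mem_target_and_symm_mem_source hy hy₀] with z hz
  ext a b
  have hφ := (contDiffAt_transition he he₀ hz.1 hz.2).differentiableAt (by simp)
  have hx : e₀.symm (transition e e₀ z) = e.symm z := e₀.left_inv hz.2
  simp only [hB, symmDeriv_eq he he₀ hz.1 hz.2, ContinuousLinearMap.comp_apply,
    fderiv_single_eq hφ, Matrix.mul_apply, Matrix.transpose_apply, hx, Fin.sum_univ_two, map_add,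
    map_smul, LinearMap.add_apply, LinearMap.smul_apply, smul_eq_mul]
  ring

/-- The contravariant tensor field with components `S` in the chart `e₀`. -/
def ofComponents (e₀ : OpenPartialHomeomorph M Coord) (S : Coord → Matrix (Fin 2) (Fin 2) ℝ) :
    ContraTensorField M := fun x =>
  ∑ i, ∑ j, S (e₀ x) i j • LinearMap.BilinForm.linMulLin
    (Module.Dual.eval ℝ (TangentSpace (𝓡 2) x) (symmDeriv e₀ (e₀ x) (EuclideanSpace.single i 1) : Coord))
    (Module.Dual.eval ℝ (TangentSpace (𝓡 2) x) (symmDeriv e₀ (e₀ x) (EuclideanSpace.single j 1) : Coord))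

theorem ofComponents_symm {S : Coord → Matrix (Fin 2) (Fin 2) ℝ} (hS : ∀ z, (S z).IsSymm) (x : M)
    (α β : Module.Dual ℝ (TangentSpace (𝓡 2) x)) :
    ofComponents e₀ S x α β = ofComponents e₀ S x β α := by
  have h10 : S (e₀ x) 1 0 = S (e₀ x) 0 1 := (hS _).apply 0 1
  simp only [ofComponents, Fin.sum_univ_two, LinearMap.add_apply, LinearMap.smul_apply,
    LinearMap.BilinForm.linMulLin_apply, smul_eq_mul, h10]
  ring

theorem ofComponents_components (he : e ∈ IsManifold.maximalAtlas (𝓡 2) ∞ M)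
    (he₀ : e₀ ∈ IsManifold.maximalAtlas (𝓡 2) ∞ M) (S : Coord → Matrix (Fin 2) (Fin 2) ℝ)
    {y : Coord} (hy : y ∈ e.target) (hy₀ : e.symm y ∈ e₀.source) :
    (ofComponents e₀ S).components e y = jac (transition e₀ e) (transition e e₀ y) *
      S (transition e e₀ y) * (jac (transition e₀ e) (transition e e₀ y)).transpose := by
  have hx : e₀.symm (transition e e₀ y) = e.symm y := e₀.left_inv hy₀
  have key : ∀ a i, coordDeriv e a (e.symm y)
      (symmDeriv e₀ (transition e e₀ y) (EuclideanSpace.single i 1)) =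
      jac (transition e₀ e) (transition e e₀ y) a i := by
    intro a i
    have h1 := coordDeriv_comp_symmDeriv he₀ he (e₀.map_source hy₀)
      (by rw [e₀.left_inv hy₀]; exact e.map_target hy) a
    have h2 := congrArg (fun L : Coord →L[ℝ] ℝ => L (EuclideanSpace.single i 1)) h1
    rw [e₀.left_inv hy₀] at h2
    exact h2
  have hcomp : ∀ a b, (ofComponents e₀ S).components e y a b = ∑ i, ∑ j,
      S (transition e e₀ y) i j *
      (coordDeriv e a (e.symm y) (symmDeriv e₀ (transition e e₀ y) (EuclideanSpace.single i 1)) *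
      coordDeriv e b (e.symm y) (symmDeriv e₀ (transition e e₀ y) (EuclideanSpace.single j 1))) := by
    intro a b
    simp only [ContraTensorField.components, Matrix.of_apply, ofComponents, Fin.sum_univ_two,
      LinearMap.add_apply, LinearMap.smul_apply, LinearMap.BilinForm.linMulLin_apply, smul_eq_mul]
    rfl
  ext a b
  rw [hcomp]
  simp only [key, Matrix.mul_apply, Matrix.transpose_apply, Fin.sum_univ_two]
  ring

theorem isPushforward_components (he : e ∈ IsManifold.maximalAtlas (𝓡 2) ∞ M)
    (he₀ : e₀ ∈ IsManifold.maximalAtlas (𝓡 2) ∞ M) (S : Coord → Matrix (Fin 2) (Fin 2) ℝ)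
    {y : Coord} (hy : y ∈ e.target) (hy₀ : e.symm y ∈ e₀.source) :
    IsPushforward (transition e e₀) ((ofComponents e₀ S).components e) S y := by
  filter_upwards [eventually_mem_target_and_symm_mem_source hy hy₀] with z hz
  have h1 := jac_transition_mul he he₀ hz.1 hz.2
  rw [ofComponents_components he he₀ S hz.1 hz.2]
  set J := jac (transition e e₀) z
  set P := jac (transition e₀ e) (transition e e₀ z)
  have h2 : J * P = 1 := mul_eq_one_comm.1 h1
  have h3 : P.transpose * J.transpose = 1 := by
    rw [← Matrix.transpose_mul, h2, Matrix.transpose_one]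
  calc S (transition e e₀ z) = (J * P) * S (transition e e₀ z) * (P.transpose * J.transpose) := by
        rw [h2, h3, Matrix.one_mul, Matrix.mul_one]
    _ = _ := by simp only [Matrix.mul_assoc]

theorem contDiffAt_ofComponents (he : e ∈ IsManifold.maximalAtlas (𝓡 2) ∞ M)
    (he₀ : e₀ ∈ IsManifold.maximalAtlas (𝓡 2) ∞ M) {S : Coord → Matrix (Fin 2) (Fin 2) ℝ}
    {y : Coord} (hy : y ∈ e.target) (hy₀ : e.symm y ∈ e₀.source)
    (hS : ∀ i j, ContDiffAt ℝ 1 (fun z => S z i j) (transition e e₀ y)) (a b : Fin 2) :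
    ContDiffAt ℝ 1 (fun z => (ofComponents e₀ S).components e z a b) y := by
  have hφ : ContDiffAt ℝ 1 (transition e e₀) y :=
    (contDiffAt_transition he he₀ hy hy₀).of_le (by exact_mod_cast le_top)
  have hψ := contDiffAt_transition he₀ he (e₀.map_source hy₀)
    (by rw [e₀.left_inv hy₀]; exact e.map_target hy)
  have hP : ∀ i j, ContDiffAt ℝ 1
      (fun z => jac (transition e₀ e) (transition e e₀ z) i j) y := fun i j =>
    ContDiffAt.comp (g := fun w => jac (transition e₀ e) w i j) y
      (contDiffAt_jac (m := 1) (n := 2) (hψ.of_le (natCast_le_infty 2)) (by norm_num) i j) hφ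
  have hSφ : ∀ i j, ContDiffAt ℝ 1 (fun z => S (transition e e₀ z) i j) y := fun i j =>
    (hS i j).comp y hφ
  have hev : (fun z => (ofComponents e₀ S).components e z a b) =ᶠ[𝓝 y] fun z =>
      ∑ j, (∑ i, jac (transition e₀ e) (transition e e₀ z) a i * S (transition e e₀ z) i j)
        * jac (transition e₀ e) (transition e e₀ z) b j := by
    filter_upwards [eventually_mem_target_and_symm_mem_source hy hy₀] with z hz
    rw [ofComponents_components he he₀ S hz.1 hz.2]
    rfl
  refine ContDiffAt.congr_of_eventuallyEq ?_ hev
  exact ContDiffAt.sum fun j _ => (ContDiffAt.sum fun i _ => (hP a i).mul (hSφ i j)).mul (hP b j)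

theorem isSymm_components {g : CovTensorField M} (hg : IsLorentzian g)
    (e : OpenPartialHomeomorph M Coord) (z : Coord) : (g.components e z).IsSymm :=
  Matrix.IsSymm.ext fun _ _ => (hg (e.symm z)).1 _ _

theorem exists_diagonalizing_matrix [IsManifold (𝓡 2) ∞ M] {g : CovTensorField M}
    (hg : IsLorentzian g) (p : M) :
    ∃ Q : Matrix (Fin 2) (Fin 2) ℝ,
      Q.transpose * g.components (chartAt Coord p) (chartAt Coord p p) * Q = !![-1, 0; 0, 1] := by
  set e := chartAt Coord p
  have hp : p ∈ e.source := mem_chart_source Coord p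
  obtain ⟨hsymm, b, h00, h11, h01⟩ := hg p
  have h10 : g p (b 1) (b 0) = 0 := by rw [hsymm, h01]
  let B : M → LinearMap.BilinForm ℝ Coord := g
  let u : Fin 2 → Coord := fun a => b a
  let D : Coord →L[ℝ] Coord := mfderiv (𝓡 2) (𝓡 2) e p
  have : IsManifold (𝓡 2) 1 M := IsManifold.of_le (n := ∞) (by exact_mod_cast le_top)
  have hinv : ∀ w : Coord, symmDeriv e (e p) (D w) = w := by
    intro w
    have := (mdifferentiable_of_mem_atlas (I := 𝓡 2) (chart_mem_atlas Coord p)).symm_comp_deriv hp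
    exact congrArg (fun L : Coord →L[ℝ] Coord => L w) this
  have hsum : ∀ a, ∑ i, D (u a) i • symmDeriv e (e p) (EuclideanSpace.single i 1) = u a := by
    intro a
    have hv : D (u a) = D (u a) 0 • EuclideanSpace.single 0 1 +
        D (u a) 1 • EuclideanSpace.single 1 1 := by
      ext i; fin_cases i <;> simp
    conv_rhs => rw [← hinv (u a), hv]
    simp [Fin.sum_univ_two]
  -- The columns of Q are the chart coordinates of the orthonormal basis at p.
  refine ⟨Matrix.of fun i a => D (u a) i, ?_⟩
  have hx : e.symm (e p) = p := e.left_inv hp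
  have hB : ∀ a b, g.components e (e p) a b =
    B p (symmDeriv e (e p) (EuclideanSpace.single a 1))
      (symmDeriv e (e p) (EuclideanSpace.single b 1)) := fun a b => by
    rw [← congrArg B hx]
    rfl
  have key : ∀ a c, ((Matrix.of fun i a => D (u a) i).transpose * g.components e (e p) *
      (Matrix.of fun i a => D (u a) i)) a c = B p (u a) (u c) := by
    intro a c
    conv_rhs => rw [← hsum a, ← hsum c]
    simp only [Matrix.mul_apply, Matrix.transpose_apply, Matrix.of_apply, hB, Fin.sum_univ_two,
      map_add, map_smul, LinearMap.add_apply, LinearMap.smul_apply, smul_eq_mul]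
    ring
  ext a c
  rw [key]
  fin_cases a <;> fin_cases c
  · exact h00
  · exact h01
  · exact h10
  · exact h11

end Charts

end Spacetime2

end

/-! ### Assembly: from one chart to all charts -/

open Spacetime2 in
theorem theorem1 {M : Type*} [TopologicalSpace M] [T2Space M]
    [ChartedSpace (EuclideanSpace ℝ (Fin 2)) M] [IsManifold (𝓡 2) ∞ M]
    (g : CovTensorField M) (hg : IsLorentzian g) (hgo : IsTimeOrientable g) (hg4 : g.IsOfClass 4)
    (Λ G : ℝ) (hG : G ≠ 0) (p : M) :
    ∃ U : Set M, IsOpen U ∧ p ∈ U ∧ ∃ T : ContraTensorField M,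
      (∀ x ∈ U, ∀ α β, T x α β = T x β α) ∧
      T.IsOfClassOn 1 U ∧
      ∀ e ∈ IsManifold.maximalAtlas (𝓡 2) ∞ M, ∀ x ∈ e.source ∩ U,
        ricciScalar (g.components e) (e x) - Λ
            = 8 * Real.pi * G * trace (g.components e) (T.components e) (e x) ∧
        ∀ a : Fin 2, divergence (g.components e) (T.components e) a (e x) = 0 := by
  have hC4 : ∀ e ∈ IsManifold.maximalAtlas (𝓡 2) ∞ M, ∀ y ∈ e.target, ∀ i j,
      ContDiffAt ℝ 4 (fun z => g.components e z i j) y := fun e he y hy i j =>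
    (hg4 e he i j).contDiffAt (e.open_target.mem_nhds hy)
  have hC2 : ∀ e ∈ IsManifold.maximalAtlas (𝓡 2) ∞ M, ∀ y ∈ e.target, ∀ i j,
      ContDiffAt ℝ 2 (fun z => g.components e z i j) y := fun e he y hy i j =>
    (hC4 e he y hy i j).of_le (by norm_num)
  let e₀ : OpenPartialHomeomorph M Coord := chartAt Coord p
  have he₀ : e₀ ∈ IsManifold.maximalAtlas (𝓡 2) ∞ M := IsManifold.chart_mem_maximalAtlas p
  have hp₀ : p ∈ e₀.source := mem_chart_source Coord p
  have hy₀ : e₀ p ∈ e₀.target := e₀.map_source hp₀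
  let h := g.components e₀
  have hs : ∀ z, (h z).IsSymm := isSymm_components hg e₀
  obtain ⟨Q, hQ⟩ := exists_diagonalizing_matrix hg p
  have hdet : (h (e₀ p)).det ≠ 0 := by
    intro h0
    have h1 := congrArg Matrix.det hQ
    rw [Matrix.det_mul, Matrix.det_mul] at h1
    change _ * (h (e₀ p)).det * _ = _ at h1
    rw [h0] at h1
    simp at h1
  have hπG : 8 * Real.pi * G ≠ 0 := mul_ne_zero (mul_ne_zero (by norm_num) Real.pi_ne_zero) hG
  let F : Coord → ℝ := fun y => (ricciScalar h y - Λ) / (8 * Real.pi * G)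
  -- Curvature costs two derivatives of the C⁴ metric; C² is what the local construction requires of
  -- F.
  have hF : ContDiffAt ℝ 2 F (e₀ p) :=
    ((contDiffAt_ricciScalar (m := 2) (hC4 e₀ he₀ _ hy₀) hdet (by norm_num)).sub
      contDiffAt_const).div_const _
  obtain ⟨S, hSs, hS, hSe⟩ := exists_local_tensor hs (hC2 e₀ he₀ _ hy₀) hF hQ
  have hev : ∀ᶠ y in 𝓝 (e₀ p), (trace h S y = F y ∧ ∀ a, divergence h S a y = 0) ∧
      (∀ i j, ContDiffAt ℝ 1 (fun z => S z i j) y) ∧ (h y).det ≠ 0 :=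
    hSe.and ((Filter.eventually_all.2 fun i => Filter.eventually_all.2 fun j =>
      (hS i j).eventually (by simp)).and
      ((contDiffAt_det (hC2 e₀ he₀ _ hy₀)).continuousAt.eventually_ne hdet))
  obtain ⟨V, hV, hVo, hpV⟩ := eventually_nhds_iff.1 hev
  refine ⟨e₀.source ∩ e₀ ⁻¹' V, e₀.isOpen_inter_preimage hVo, ⟨hp₀, hpV⟩, ofComponents e₀ S,
    fun x _ α β => ofComponents_symm hSs x α β, ?_, ?_⟩
  · rintro e he a b y ⟨hy, hyU⟩
    exact (contDiffAt_ofComponents he he₀ hy hyU.1 (hV _ hyU.2).2.1 a b).contDiffWithinAt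
  · rintro e he x ⟨hxe, hxU⟩
    have hy : e x ∈ e.target := e.map_source hxe
    have hex : e.symm (e x) = x := e.left_inv hxe
    have hy₀ : e.symm (e x) ∈ e₀.source := by rw [hex]; exact hxU.1
    have hφx : transition e e₀ (e x) = e₀ x := by rw [transition, hex]
    obtain ⟨⟨htr, hdiv⟩, hSc, hd⟩ := hV (transition e e₀ (e x)) (by rw [hφx]; exact hxU.2)
    have hφ := contDiffAt_transition he he₀ hy hy₀
    have hpb := isPullback_components g he he₀ hy hy₀
    have hpf := isPushforward_components he he₀ S hy hy₀
    have hJ1 := jac_transition_mul he he₀ hy hy₀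
    have hJ : (jac (transition e e₀) (e x)).det ≠ 0 := by
      intro h0
      have h1 := congrArg Matrix.det hJ1
      rw [Matrix.det_mul, h0, mul_zero, Matrix.det_one] at h1
      exact zero_ne_one h1
    have hC2₀ := hC2 e₀ he₀ _ (e₀.map_source hy₀)
    constructor
    · rw [hpb.trace_eq hpf, hpb.ricciScalar_eq (hφ.of_le (natCast_le_infty 3)) hs hd hJ hC2₀
        (hC2 e he _ hy)]
      change _ = 8 * Real.pi * G * trace h S _
      rw [htr]
      simp only [F, h]
      field_simp
    · have hdivJ := hpb.divergence_eq hpf (hφ.of_le (natCast_le_infty 2)) hs hd hJ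
        (fun i j => (hC2₀ i j).differentiableAt (by norm_num))
        (fun i j => (hSc i j).differentiableAt one_ne_zero)
        (fun i j => (contDiffAt_ofComponents he he₀ hy hy₀ hSc i j).differentiableAt one_ne_zero)
      -- The divergence in the chart e is mapped by the invertible Jacobian to the divergence in e₀,
      -- which vanishes.
      have hzero : (jac (transition e e₀) (e x)).mulVec (fun a =>
          divergence (g.components e) ((ofComponents e₀ S).components e) a (e x)) = 0 :=
        funext fun i => (hdivJ i).trans (hdiv i)
      exact congrFun (Matrix.eq_zero_of_mulVec_eq_zero hJ hzero)
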